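/- Let $\pi\colon E=\mathbb R^3(t,x,y)\times\mathbb R^2(u,v)\to\mathbb R^3(t,x,y)$ and consider the modified Manakov--Santini system $$F_1=(u_t+uu_y+vu_x)_x-(u_y)_y=0,\qquad F_2=(v_t+vv_x-uv_y)_x-(v_y-2uv_x)_y=0.$$ Let $\mathcal{MS}_2=\{F_1=F_2=0\}\subset J^2\pi$, let $\mathcal{MS}_k\subset J^k\pi$ for $k\ge 2$ be its prolongation, i.e. the common zero set of the total derivatives $D_\tau F_i$ with $|\tau|\le k-2$, and put $\mathcal{MS}_0=J^0\pi=E$, $\mathcal{MS}_1=J^1\pi$. Let $\mathfrak g$ be the Lie algebra of point symmetries of the system, i.e. of the smooth vector fields $X$ on $E$ whose second prolongation satisfies $(L_{X^{(2)}}F_i)|_{\mathcal{MS}_2}=0$ for $i=1,2$, and let $\mathfrak g^{(k)}=\{X^{(k)}:X\in\mathfrak g\}$ be its prolongation to $J^k\pi$. The orbit of $\mathfrak g^{(k)}$ through $\theta\in\mathcal{MS}_k$ has tangent space $\operatorname{span}\{X^{(k)}_\theta : X\in\mathfrak g\}$ at $\theta$, and its dimension is the dimension of this space. Proposition. A generic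 orbit $\mathcal O_k$ of $\mathfrak g^{(k)}$ on $\mathcal{MS}_k$ satisfies $$\dim\mathcal O_0=5,\qquad \dim\mathcal O_1=11,\qquad \dim\mathcal O_k=5k+8\quad\text{for all } k\ge 2.$$ Here generic means: for every $k\ge0$ there is a polynomial $P$ in the standard coordinates of $J^k\pi$ such that $\{\theta\in\mathcal{MS}_k: P(\theta)\ne0\}$ is dense in $\mathcal{MS}_k$ and the orbit through each point of this set has the stated dimension. -/

import Mathlib

open scoped ContDiff

noncomputable section

namespace MSJet

/-- The base `M = ℝ³`, with coordinates `0 ↦ t`, `1 ↦ x`, `2 ↦ y`. -/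
abbrev Base : Type := Fin 3 → ℝ

/-- The total space `E = M × ℝ²`, with fibre coordinates `0 ↦ u`, `1 ↦ v`. -/
abbrev Total : Type := Base × (Fin 2 → ℝ)

/-- Multi-indices `σ = (σ_t, σ_x, σ_y)` with `|σ| ≤ k`. -/
abbrev MultiIndex (k : ℕ) : Type := {σ : Fin 3 → ℕ // ∑ i, σ i ≤ k}

instance instFiniteMultiIndex (k : ℕ) : Finite (MultiIndex k) :=
  Finite.of_injective
    (fun σ : MultiIndex k => fun i : Fin 3 =>
      (⟨σ.1 i, Nat.lt_succ_of_le
        ((Finset.single_le_sum (f := σ.1) (fun _ _ => Nat.zero_le _) (Finset.mem_univ i)).trans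
          σ.2)⟩ : Fin (k + 1)))
    (fun σ τ h => Subtype.ext (funext fun i => congrArg Fin.val (congrFun h i)))

instance instFintypeMultiIndex (k : ℕ) : Fintype (MultiIndex k) := Fintype.ofFinite _

/-- The jet space `J^k π` of the trivial bundle `π : E → M` in its standard coordinates: the base
point and the jet variables `u_σ` (index `(0, σ)`) and `v_σ` (index `(1, σ)`), `|σ| ≤ k`. Being
a vector space, it is also its own tangent space at each point. -/
abbrev Jet (k : ℕ) : Type := Base × (Fin 2 × MultiIndex k → ℝ)

/-- The partial derivative `∂f/∂x^i`. -/
def pderiv (i : Fin 3) (f : Base → ℝ) : Base → ℝ :=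
  fun z => fderiv ℝ f z (Pi.single i 1)

/-- The iterated partial derivative `∂^σ f = ∂_t^{σ_t} ∂_x^{σ_x} ∂_y^{σ_y} f`. -/
def pderivs (σ : Fin 3 → ℕ) (f : Base → ℝ) : Base → ℝ :=
  (pderiv 0)^[σ 0] ((pderiv 1)^[σ 1] ((pderiv 2)^[σ 2] f))

/-- The `k`-jet at `z` of the section `s = (s^0, s^1) = (u, v)`. -/
def jetOf (k : ℕ) (s : Fin 2 → Base → ℝ) (z : Base) : Jet k :=
  (z, fun p => pderivs p.2.1 (s p.1) z)

/-- The Taylor polynomial section with `k`-jet `θ`: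
`s^α(z) = ∑_{|σ| ≤ k} u^α_σ (z - x)^σ / σ!`, where `x` is the base point of `θ`. -/
def taylor {k : ℕ} (θ : Jet k) (α : Fin 2) : Base → ℝ :=
  fun z => ∑ σ : MultiIndex k, θ.2 (α, σ) * ∏ i, (z i - θ.1 i) ^ σ.1 i / (Nat.factorial (σ.1 i) : ℝ)

/-- The coordinate `u_{t^a x^b y^c}` (for `α = 0`) or `v_{t^a x^b y^c}` (for `α = 1`)
on second order jets. -/
def coord (θ : Jet 2) (α : Fin 2) (a b c : ℕ)
    (h : ∑ i, ![a, b, c] i ≤ 2 := by simp [Fin.sum_univ_three]) : ℝ :=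
  θ.2 (α, ⟨![a, b, c], h⟩)

/-- `F₁ = (u_t + u u_y + v u_x)_x - (u_y)_y`, expanded. -/
def F₁ (θ : Jet 2) : ℝ :=
  coord θ 0 1 1 0
    + (coord θ 0 0 1 0 * coord θ 0 0 0 1 + coord θ 0 0 0 0 * coord θ 0 0 1 1)
    + (coord θ 1 0 1 0 * coord θ 0 0 1 0 + coord θ 1 0 0 0 * coord θ 0 0 2 0)
    - coord θ 0 0 0 2

/-- `F₂ = (v_t + v v_x - u v_y)_x - (v_y - 2 u v_x)_y`, expanded. -/
def F₂ (θ : Jet 2) : ℝ :=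
  coord θ 1 1 1 0
    + (coord θ 1 0 1 0 * coord θ 1 0 1 0 + coord θ 1 0 0 0 * coord θ 1 0 2 0)
    - (coord θ 0 0 1 0 * coord θ 1 0 0 1 + coord θ 0 0 0 0 * coord θ 1 0 1 1)
    - (coord θ 1 0 0 2
        - 2 * (coord θ 0 0 0 1 * coord θ 1 0 1 0 + coord θ 0 0 0 0 * coord θ 1 0 1 1))

/-- The modified Manakov-Santini system `(F₁, F₂)`. -/
def F : Fin 2 → Jet 2 → ℝ := ![F₁, F₂]

/-- The prolonged equation `MS_k ⊆ J^k π`: the common zero set of the total derivatives `D_τ F_i`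
with `|τ| + 2 ≤ k`. By definition of the total derivative, `D_τ F_i` at the jet of a section is
the derivative `∂^τ` of `F_i` restricted to the 2-jet of the section; since `D_τ F_i` has order at
most `k`, the Taylor section of `θ` computes its value at `θ`. For `k = 0, 1` the condition
is empty and `MS_k = J^k π`. -/
def MS (k : ℕ) : Set (Jet k) :=
  {θ | ∀ (i : Fin 2) (τ : Fin 3 → ℕ), ∑ j, τ j + 2 ≤ k →
    pderivs τ (fun z => F i (jetOf 2 (taylor θ) z)) θ.1 = 0}

/-- The projection `J^k π → E`. -/
def toTotal {k : ℕ} (θ : Jet k) : Total :=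
  (θ.1, fun α => θ.2 (α, ⟨0, by simp⟩))

/-- The generating section `φ = (φ_u, φ_v)` of the vector field `X` on `E`,
`φ^α = X^α - ∑ i, X^i u^α_i`, evaluated along the section `s`. -/
def genSection (X : Total → Total) (s : Fin 2 → Base → ℝ) (α : Fin 2) : Base → ℝ :=
  fun z => (X (z, fun β => s β z)).2 α - ∑ i, (X (z, fun β => s β z)).1 i * pderiv i (s α) z

/-- The value at `θ` of the `k`-th prolongation
`X^(k) = ∑ i, X^i D_i^(k+1) + ∑_{|σ| ≤ k} (D_σ φ_u ∂_{u_σ} + D_σ φ_v ∂_{v_σ})`,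
where `D_i^(k+1) = ∂_i + ∑_{|σ| ≤ k} (u_{σ i} ∂_{u_σ} + v_{σ i} ∂_{v_σ})`.
The right-hand side does not depend on the jet variables of order `k + 1`, so it may be computed
on any section with `k`-jet `θ`; the Taylor section of `θ` is used. -/
def prolong (k : ℕ) (X : Total → Total) (θ : Jet k) : Jet k :=
  ((X (toTotal θ)).1, fun p =>
    pderivs p.2.1 (genSection X (taylor θ) p.1) θ.1
      + ∑ i, (X (toTotal θ)).1 i * pderivs (p.2.1 + Pi.single i 1) (taylor θ p.1) θ.1)

/-- The Lie algebra `g` of (infinitesimal point) symmetries of the system: the smooth vector fields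
`X` on `E` with `L_{X^(2)} F_i = 0` on `MS_2 = {F₁ = F₂ = 0}`. -/
def IsSymmetry (X : Total → Total) : Prop :=
  ContDiff ℝ ∞ X ∧
    ∀ θ : Jet 2, (∀ i, F i θ = 0) → ∀ i, fderiv ℝ (F i) θ (prolong 2 X θ) = 0

/-- The tangent space at `θ` of the orbit of `g^(k)` through `θ`: the span of the values at `θ` of
the prolonged symmetries. -/
def orbitTangent (k : ℕ) (θ : Jet k) : Submodule ℝ (Jet k) :=
  Submodule.span ℝ {w | ∃ X : Total → Total, IsSymmetry X ∧ w = prolong k X θ}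

/-- The dimension of the orbit of `g^(k)` through `θ`. -/
def orbitDim (k : ℕ) (θ : Jet k) : ℕ := Module.finrank ℝ (orbitTangent k θ)

/-- The value at the jet `θ` of a polynomial in the coordinates of `J^k π`. -/
def evalJet {k : ℕ} (P : MvPolynomial (Fin 3 ⊕ Fin 2 × MultiIndex k) ℝ) (θ : Jet k) : ℝ :=
  MvPolynomial.eval (Sum.elim θ.1 θ.2) P

/-- A generic orbit of `g^(k)` on `MS_k` has dimension `d`: there is a Zariski open subset
`{P ≠ 0}` of `MS_k`, dense in `MS_k`, such that the orbit through each of its points has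
dimension `d`. -/
def GenericOrbitDim (k d : ℕ) : Prop :=
  ∃ P : MvPolynomial (Fin 3 ⊕ Fin 2 × MultiIndex k) ℝ,
    MS k ⊆ closure {θ | θ ∈ MS k ∧ evalJet P θ ≠ 0} ∧
      ∀ θ ∈ MS k, evalJet P θ ≠ 0 → orbitDim k θ = d

end MSJet

end

noncomputable section

namespace MSJet

/-! Write `h = (h 0, h 1, h 2)` for the base components of a point symmetry. The determining
equations force them to be independent of `u, v`, and with arbitrary functions `a, c, d, e, f` of
`t` they read `h 0 = a`, `h 2 = c y + d`, `h 1 = (2c - a') x + (2c' - a'') y²/2 + e y + f`; the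
fibre components are then fixed by `field`. Sufficiency is a pair of identities valid along every
section (`linearized_F₁`, `linearized_F₂`). Necessity (`exists_eq_field`) comes from evaluating the
symmetry condition for `F₁` at well-chosen 2-jets on the equation.

The prolongation to order `k` at a point sees `a, d, f` through their derivatives of order at most
`k + 1`, and `c, e` through those of order at most `k`. These are `3(k + 2) + 2(k + 1) = 5k + 8`
numbers, so `5k + 8` bounds every orbit dimension (`orbitDim_le`), and the defect is the dimension
of the isotropy in this parameter space.

An isotropy element has zero base value. If moreover `a'`, `c` and `∂_y h 1` vanish at the point, an
induction on the order kills all parameters (`van_of_genS_eq_zero`). For `k = 0` these three numbers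
remain, so the dimension is at least `8 - 3 = 5`; for `k = 1` the condition `u_x ≠ 0` kills `c`,
giving `13 - 2 = 11`; for `k ≥ 2` the condition `u_xx ≠ 0` kills the other two. In the first two
cases the bound equals the dimension of the whole jet space.

Density of `u_x ≠ 0`, `u_xx ≠ 0` in `MS k` holds because the system is solved for `u_yy, v_yy`: jet
variables with `σ_y ≤ 1` are free coordinates (`subset_closure_ne_zero`). -/

/-! ### Smooth functions with commuting derivations. -/

/-- The algebra of smooth functions on the base. -/
def Sm : Subalgebra ℝ (Base → ℝ) where
  carrier := {f | ContDiff ℝ ∞ f}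
  mul_mem' := fun {f g} (hf : ContDiff ℝ ∞ f) (hg : ContDiff ℝ ∞ g) => hf.mul hg
  add_mem' := fun {f g} (hf : ContDiff ℝ ∞ f) (hg : ContDiff ℝ ∞ g) => hf.add hg
  algebraMap_mem' := fun c => (contDiff_const : ContDiff ℝ ∞ fun _ : Base => c)

theorem contDiff_coe (f : Sm) : ContDiff ℝ ∞ (f : Base → ℝ) := f.2

theorem differentiableAt_coe (f : Sm) (z : Base) : DifferentiableAt ℝ (f : Base → ℝ) z :=
  ((contDiff_coe f).differentiable (by simp)) z

theorem contDiff_pderiv {f : Base → ℝ} (hf : ContDiff ℝ ∞ f) (i : Fin 3) :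
    ContDiff ℝ ∞ (pderiv i f) :=
  (hf.fderiv_right (m := ∞) (by simp)).clm_apply contDiff_const

theorem pderiv_comm {f : Base → ℝ} (hf : ContDiff ℝ ∞ f) (i j : Fin 3) :
    pderiv i (pderiv j f) = pderiv j (pderiv i f) := by
  have key : ∀ (a b : Fin 3) (z : Base), pderiv a (pderiv b f) z
      = fderiv ℝ (fderiv ℝ f) z (Pi.single a 1) (Pi.single b 1) := by
    intro a b z
    have h1 : DifferentiableAt ℝ (fderiv ℝ f) z :=
      ((hf.fderiv_right (m := ∞) (by simp)).differentiable (by simp)) z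
    have h2 := (h1.hasFDerivAt.clm_apply
      (hasFDerivAt_const (Pi.single b 1 : Base) z)).fderiv
    have h3 : pderiv b f = fun y => fderiv ℝ f y (Pi.single b 1) := rfl
    change fderiv ℝ (pderiv b f) z (Pi.single a 1) = _
    rw [h3, h2]
    simp
  funext z
  rw [key, key]
  exact ((hf.contDiffAt (x := z)).isSymmSndFDerivAt (by
    simpa using (WithTop.coe_le_coe.2 le_top : ((2 : ℕ∞) : WithTop ℕ∞) ≤ ∞))) _ _

/-- The partial derivative as a derivation of the algebra of smooth functions. -/
def D (i : Fin 3) : Derivation ℝ Sm Sm :=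
  Derivation.mk'
    { toFun := fun f => ⟨pderiv i f, contDiff_pderiv f.2 i⟩
      map_add' := fun f g => by
        ext z
        change pderiv i (f.1 + g.1) z = pderiv i f.1 z + pderiv i g.1 z
        simp [pderiv, fderiv_add (differentiableAt_coe f z) (differentiableAt_coe g z)]
      map_smul' := fun c f => by
        ext z
        change pderiv i (c • f.1) z = c • pderiv i f.1 z
        simp [pderiv, fderiv_const_smul (differentiableAt_coe f z)] }
    (fun f g => by
      ext z
      change pderiv i (f.1 * g.1) z = f.1 z * pderiv i g.1 z + g.1 z * pderiv i f.1 z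
      simp [pderiv, fderiv_mul (differentiableAt_coe f z) (differentiableAt_coe g z)])

@[simp] theorem coe_D (i : Fin 3) (f : Sm) : ((D i f : Sm) : Base → ℝ) = pderiv i f := rfl

theorem D_comm (i j : Fin 3) (f : Sm) : D i (D j f) = D j (D i f) :=
  Subtype.ext (pderiv_comm f.2 i j)

theorem D_one_zero (f : Sm) : D 1 (D 0 f) = D 0 (D 1 f) := D_comm _ _ _
theorem D_two_zero (f : Sm) : D 2 (D 0 f) = D 0 (D 2 f) := D_comm _ _ _
theorem D_two_one (f : Sm) : D 2 (D 1 f) = D 1 (D 2 f) := D_comm _ _ _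

/-- The iterated partial derivative `∂^σ` as a linear map. -/
def Dm (σ : Fin 3 → ℕ) : Module.End ℝ Sm :=
  (D 0 : Module.End ℝ Sm) ^ σ 0 * (D 1 : Module.End ℝ Sm) ^ σ 1 * (D 2 : Module.End ℝ Sm) ^ σ 2

theorem coe_iterate_D (i : Fin 3) (n : ℕ) (f : Sm) :
    ((((D i : Module.End ℝ Sm) ^ n) f : Sm) : Base → ℝ) = (pderiv i)^[n] f := by
  induction n with
  | zero => rfl
  | succ n ih =>
    rw [pow_succ', Function.iterate_succ_apply', ← ih]
    rfl

theorem coe_Dm (σ : Fin 3 → ℕ) (f : Sm) : ((Dm σ f : Sm) : Base → ℝ) = pderivs σ f := by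
  simp only [Dm, Module.End.mul_apply, coe_iterate_D, pderivs]

theorem commute_D (i j : Fin 3) : Commute (D i : Module.End ℝ Sm) (D j : Module.End ℝ Sm) :=
  LinearMap.ext fun f => D_comm i j f

theorem Dm_add (σ τ : Fin 3 → ℕ) : Dm (σ + τ) = Dm σ * Dm τ := by
  have h10 := ((commute_D 1 0).pow_pow (σ 1) (τ 0)).eq
  have h20 := ((commute_D 2 0).pow_pow (σ 2) (τ 0)).eq
  have h21 := ((commute_D 2 1).pow_pow (σ 2) (τ 1)).eq
  simp only [Dm, Pi.add_apply, pow_add]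
  generalize (D 0 : Module.End ℝ Sm) ^ σ 0 = a0 at *
  generalize (D 1 : Module.End ℝ Sm) ^ σ 1 = a1 at *
  generalize (D 2 : Module.End ℝ Sm) ^ σ 2 = a2 at *
  generalize (D 0 : Module.End ℝ Sm) ^ τ 0 = b0 at *
  generalize (D 1 : Module.End ℝ Sm) ^ τ 1 = b1 at *
  generalize (D 2 : Module.End ℝ Sm) ^ τ 2 = b2 at *
  calc a0 * b0 * (a1 * b1) * (a2 * b2) = a0 * (b0 * a1) * (b1 * a2) * b2 := by
        simp only [mul_assoc]
    _ = a0 * (a1 * b0) * (a2 * b1) * b2 := by rw [h10, h21]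
    _ = a0 * a1 * (b0 * a2) * b1 * b2 := by simp only [mul_assoc]
    _ = a0 * a1 * (a2 * b0) * b1 * b2 := by rw [h20]
    _ = a0 * a1 * a2 * (b0 * b1 * b2) := by simp only [mul_assoc]

theorem Dm_Dm (σ τ : Fin 3 → ℕ) (f : Sm) : Dm σ (Dm τ f) = Dm (σ + τ) f := by
  rw [Dm_add]; rfl

@[simp] theorem Dm_zero (f : Sm) : Dm 0 f = f := rfl

theorem Dm_single (i : Fin 3) (f : Sm) : Dm (Pi.single i 1) f = D i f := by
  fin_cases i <;> simp [Dm]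

theorem Dm_D (σ : Fin 3 → ℕ) (i : Fin 3) (f : Sm) : Dm σ (D i f) = Dm (σ + Pi.single i 1) f := by
  rw [← Dm_single, Dm_Dm]

/-- Evaluation at a point. -/
def ev (x : Base) : Sm →ₐ[ℝ] ℝ := (Pi.evalAlgHom ℝ (fun _ : Base => ℝ) x).comp Sm.val

theorem ev_apply (x : Base) (f : Sm) : ev x f = (f : Base → ℝ) x := rfl

theorem pderivs_eq_ev (σ : Fin 3 → ℕ) (f : Sm) (x : Base) :
    pderivs σ (f : Base → ℝ) x = ev x (Dm σ f) := by
  rw [ev_apply, coe_Dm]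

theorem exists_eq_add_single {σ : Fin 3 → ℕ} (h : σ ≠ 0) :
    ∃ (τ : Fin 3 → ℕ) (i : Fin 3), σ = τ + Pi.single i 1 := by
  obtain ⟨i, hi⟩ := Function.ne_iff.1 h
  refine ⟨σ - Pi.single i 1, i, (tsub_add_cancel_of_le fun j => ?_).symm⟩
  by_cases hj : j = i
  · subst hj
    simpa using Nat.one_le_iff_ne_zero.2 hi
  · simp [hj]

theorem sum_add_single (τ : Fin 3 → ℕ) (i : Fin 3) :
    ∑ j, (τ + Pi.single i 1 : Fin 3 → ℕ) j = ∑ j, τ j + 1 := by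
  simp [Finset.sum_add_distrib]

/-! ### Divided-power monomials and Taylor sections. -/

/-- The centred coordinate function `z ↦ z i - x i`. -/
def cen (x : Base) (i : Fin 3) : Sm :=
  ⟨fun z => z i - x i,
    (((contDiff_apply ℝ ℝ i).sub contDiff_const) : ContDiff ℝ ∞ fun z : Base => z i - x i)⟩

@[simp] theorem D_cen (x : Base) (i j : Fin 3) : D i (cen x j) = if i = j then 1 else 0 := by
  ext z
  have h : HasFDerivAt (fun z : Base => z j - x j)
      (ContinuousLinearMap.proj (R := ℝ) (φ := fun _ : Fin 3 => ℝ) j) z :=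
    (hasFDerivAt_apply j z).sub_const _
  have : pderiv i (fun z : Base => z j - x j) z = if i = j then 1 else 0 := by
    simp [pderiv, h.fderiv, Pi.single_apply, eq_comm]
  rw [coe_D]
  refine this.trans ?_
  split_ifs <;> rfl

@[simp] theorem ev_cen (x : Base) (i : Fin 3) : ev x (cen x i) = 0 := sub_self _

/-- The divided power `(z i - x i)^n / n!`. -/
def dpow (x : Base) (i : Fin 3) (n : ℕ) : Sm := ((Nat.factorial n : ℝ)⁻¹) • cen x i ^ n

@[simp] theorem dpow_zero (x : Base) (i : Fin 3) : dpow x i 0 = 1 := by simp [dpow]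

theorem D_dpow_succ (x : Base) (i : Fin 3) (n : ℕ) : D i (dpow x i (n + 1)) = dpow x i n := by
  have : ((n : ℝ) + 1) ≠ 0 := by positivity
  have h2 : (Nat.factorial n : ℝ) ≠ 0 := by positivity
  simp only [dpow, Derivation.map_smul, Derivation.leibniz_pow, D_cen, if_true,
    Nat.add_sub_cancel, smul_eq_mul, mul_one, ← Nat.cast_smul_eq_nsmul ℝ, smul_smul]
  congr 1
  rw [Nat.factorial_succ]
  push_cast
  field_simp

theorem D_dpow_of_ne (x : Base) {i j : Fin 3} (h : i ≠ j) (n : ℕ) : D i (dpow x j n) = 0 := by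
  simp [dpow, Derivation.leibniz_pow, h]

theorem ev_dpow (x : Base) (i : Fin 3) (n : ℕ) : ev x (dpow x i n) = if n = 0 then 1 else 0 := by
  cases n <;> simp [dpow]

/-- The monomial `(z - x)^ρ / ρ!`. -/
def monom (x : Base) (ρ : Fin 3 → ℕ) : Sm := ∏ i, dpow x i (ρ i)

theorem D_monom_succ (x : Base) (ρ : Fin 3 → ℕ) (i : Fin 3) :
    D i (monom x (ρ + Pi.single i 1)) = monom x ρ := by
  fin_cases i <;>
  simp [monom, Fin.prod_univ_three, Derivation.leibniz, D_dpow_succ, D_dpow_of_ne, mul_comm,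
    mul_left_comm]

theorem D_monom_zero (x : Base) (ρ : Fin 3 → ℕ) (i : Fin 3) (h : ρ i = 0) :
    D i (monom x ρ) = 0 := by
  fin_cases i <;> simp at h <;>
  simp [monom, Fin.prod_univ_three, Derivation.leibniz, D_dpow_of_ne, h]

theorem ev_monom (x : Base) (ρ : Fin 3 → ℕ) : ev x (monom x ρ) = if ρ = 0 then 1 else 0 := by
  have : ρ = 0 ↔ (ρ 0 = 0 ∧ ρ 1 = 0 ∧ ρ 2 = 0) := by
    simp [funext_iff, Fin.forall_fin_succ]
  simp only [monom, Fin.prod_univ_three, map_mul, ev_dpow, this]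
  split_ifs <;> simp_all

theorem ev_Dm_monom (x : Base) (σ ρ : Fin 3 → ℕ) :
    ev x (Dm σ (monom x ρ)) = if σ = ρ then 1 else 0 := by
  induction hn : ∑ j, σ j generalizing σ ρ with
  | zero =>
    have : σ = 0 := funext fun j => by simpa using (Finset.sum_eq_zero_iff.1 hn) j (by simp)
    subst this
    simp [ev_monom, eq_comm]
  | succ n ih =>
    have h0 : σ ≠ 0 := by rintro rfl; simp at hn
    obtain ⟨τ, i, rfl⟩ := exists_eq_add_single h0
    rw [sum_add_single] at hn
    rw [← Dm_D]
    rcases Nat.eq_zero_or_pos (ρ i) with hρ | hρ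
    · rw [D_monom_zero x ρ i hρ, map_zero, map_zero, if_neg]
      rintro rfl
      simp at hρ
    · have : ρ = (ρ - Pi.single i 1) + Pi.single i 1 :=
        (tsub_add_cancel_of_le fun j => by
          by_cases hj : j = i
          · subst hj; simp only [Pi.single_eq_same]; omega
          · simp [hj]).symm
      rw [this, D_monom_succ, ih _ _ (by omega)]
      simp only [add_left_inj]

/-- The Taylor section of a jet, as a pair of smooth functions. -/
def tay {k : ℕ} (θ : Jet k) (α : Fin 2) : Sm := ∑ σ : MultiIndex k, θ.2 (α, σ) • monom θ.1 σ.1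

theorem coe_tay {k : ℕ} (θ : Jet k) (α : Fin 2) : (tay θ α : Base → ℝ) = taylor θ α := by
  funext z
  change ev z (tay θ α) = _
  simp only [tay, taylor, map_sum, map_smul, monom, map_prod, dpow, map_pow, smul_eq_mul]
  refine Finset.sum_congr rfl fun σ _ => ?_
  congr 1
  refine Finset.prod_congr rfl fun i _ => ?_
  rw [div_eq_inv_mul]
  rfl

/-- The value `0` beyond order `k` lets derivatives of any order be taken without side conditions.
-/
theorem ev_Dm_tay {k : ℕ} (θ : Jet k) (α : Fin 2) (σ : Fin 3 → ℕ) :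
    ev θ.1 (Dm σ (tay θ α)) = if h : ∑ i, σ i ≤ k then θ.2 (α, ⟨σ, h⟩) else 0 := by
  simp only [tay, map_sum, map_smul, ev_Dm_monom, smul_eq_mul, mul_ite, mul_one, mul_zero]
  split_ifs with h
  · rw [Finset.sum_eq_single ⟨σ, h⟩]
    · simp
    · rintro ρ - hρ
      rw [if_neg]
      rintro rfl
      exact hρ rfl
    · simp
  · refine Finset.sum_eq_zero fun ρ _ => if_neg ?_
    rintro rfl
    exact h ρ.2

/-! ### The prolonged equation as a graph over the jet variables with `σ_y ≤ 1`. -/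

/-- The functions on the jet space that are continuous and only depend on the base point and on
the jet variables `u_σ`, `v_σ` with `σ_y ≤ r`. -/
def lowDep (k r : ℕ) : Subalgebra ℝ (Jet k → ℝ) where
  carrier := {g | Continuous g ∧ ∀ θ θ' : Jet k, θ.1 = θ'.1 →
    (∀ q : Fin 2 × MultiIndex k, q.2.1 2 ≤ r → θ.2 q = θ'.2 q) → g θ = g θ'}
  mul_mem' := fun hf hg => ⟨hf.1.mul hg.1, fun θ θ' h0 h => by
    simp only [Pi.mul_apply, hf.2 θ θ' h0 h, hg.2 θ θ' h0 h]⟩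
  add_mem' := fun hf hg => ⟨hf.1.add hg.1, fun θ θ' h0 h => by
    simp only [Pi.add_apply, hf.2 θ θ' h0 h, hg.2 θ θ' h0 h]⟩
  algebraMap_mem' := fun c => ⟨(continuous_const : Continuous fun _ : Jet k => c),
    fun _ _ _ _ => rfl⟩

theorem lowDep_mono (k : ℕ) {r r' : ℕ} (h : r ≤ r') : lowDep k r ≤ lowDep k r' :=
  fun _ hg => ⟨hg.1, fun θ θ' h0 h1 => hg.2 θ θ' h0 fun q hq => h1 q (hq.trans h)⟩

/-- The family `f θ` of smooth functions involves derivatives of the Taylor section of `θ` of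
`y`-order at most `r`. -/
def YOrder {k : ℕ} (r : ℕ) (f : Jet k → Sm) : Prop :=
  ∀ τ : Fin 3 → ℕ, (fun θ => ev θ.1 (Dm τ (f θ))) ∈ lowDep k (τ 2 + r)

namespace YOrder

variable {k r : ℕ} {f g : Jet k → Sm}

theorem mono {r' : ℕ} (hf : YOrder r f) (h : r ≤ r') : YOrder r' f :=
  fun τ => lowDep_mono k (Nat.add_le_add_left h _) (hf τ)

theorem add (hf : YOrder r f) (hg : YOrder r g) : YOrder r (fun θ => f θ + g θ) := by
  intro τ
  simp only [map_add]
  exact add_mem (hf τ) (hg τ)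

theorem sub (hf : YOrder r f) (hg : YOrder r g) : YOrder r (fun θ => f θ - g θ) := by
  intro τ
  simp only [map_sub]
  exact sub_mem (hf τ) (hg τ)

theorem deriv (hf : YOrder r f) (i : Fin 3) :
    YOrder (r + (Pi.single i 1 : Fin 3 → ℕ) 2) (fun θ => D i (f θ)) := by
  intro τ
  simp only [Dm_D]
  have := hf (τ + Pi.single i 1)
  rwa [Pi.add_apply, add_assoc, add_comm _ r] at this

/-- The induction generalizes `r`: when Leibniz moves a `∂_y` onto one factor, `r` grows by one
while the remaining multi-index loses one `y`, so the total bound is preserved. -/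
theorem mul (hf : YOrder r f) (hg : YOrder r g) : YOrder r (fun θ => f θ * g θ) := by
  intro τ
  induction hn : ∑ j, τ j generalizing τ r f g with
  | zero =>
    have : τ = 0 := funext fun j => by simpa using (Finset.sum_eq_zero_iff.1 hn) j (by simp)
    subst this
    simp only [Dm_zero, map_mul]
    exact mul_mem (hf 0) (hg 0)
  | succ n ih =>
    have h0 : τ ≠ 0 := by rintro rfl; simp at hn
    obtain ⟨ρ, i, rfl⟩ := exists_eq_add_single h0
    rw [sum_add_single] at hn
    simp only [← Dm_D, Derivation.leibniz, smul_eq_mul, map_add]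
    have key := add_mem (ih (hf.mono (Nat.le_add_right _ _)) (hg.deriv i) ρ (by omega))
      (ih (hg.mono (Nat.le_add_right _ _)) (hf.deriv i) ρ (by omega))
    rw [Pi.add_apply, add_assoc, add_comm _ r]
    exact key

theorem tay (k : ℕ) (α : Fin 2) : YOrder 0 (fun θ : Jet k => tay θ α) := by
  intro τ
  simp only [ev_Dm_tay]
  by_cases h : ∑ i, τ i ≤ k
  · simp only [h, dif_pos]
    exact ⟨by fun_prop, fun θ θ' _ h1 => h1 _ (by simp)⟩
  · simp only [h, dif_neg, not_false_iff]
    exact zero_mem _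

end YOrder

/-- The differential polynomials `F₁ + u_yy`, `F₂ + v_yy`, evaluated on the section `s`. -/
def rhsS (s : Fin 2 → Sm) : Fin 2 → Sm :=
  ![D 0 (D 1 (s 0)) + (D 1 (s 0) * D 2 (s 0) + s 0 * D 1 (D 2 (s 0)))
      + (D 1 (s 1) * D 1 (s 0) + s 1 * D 1 (D 1 (s 0))),
    D 0 (D 1 (s 1)) + (D 1 (s 1) * D 1 (s 1) + s 1 * D 1 (D 1 (s 1)))
      - (D 1 (s 0) * D 2 (s 1) + s 0 * D 1 (D 2 (s 1)))
      + (D 2 (s 0) * D 1 (s 1) + D 2 (s 0) * D 1 (s 1)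
        + (s 0 * D 1 (D 2 (s 1)) + s 0 * D 1 (D 2 (s 1))))]

/-- The bound `1` is strictly below the `y`-order `2` of the solved derivatives `u_yy`, `v_yy`; this
makes the system triangular in `σ_y`. -/
theorem yOrder_rhsS (k : ℕ) (i : Fin 2) : YOrder 1 (fun θ : Jet k => rhsS (tay θ) i) := by
  have h0 : ∀ α, YOrder 1 (fun θ : Jet k => tay θ α) :=
    fun α => (YOrder.tay k α).mono (by simp)
  have h1 : ∀ α, YOrder 1 (fun θ : Jet k => D 1 (tay θ α)) :=
    fun α => ((YOrder.tay k α).deriv 1).mono (by simp)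
  have h2 : ∀ α, YOrder 1 (fun θ : Jet k => D 2 (tay θ α)) :=
    fun α => ((YOrder.tay k α).deriv 2).mono (by simp)
  have h01 : ∀ α, YOrder 1 (fun θ : Jet k => D 0 (D 1 (tay θ α))) :=
    fun α => ((h1 α).deriv 0).mono (by simp)
  have h11 : ∀ α, YOrder 1 (fun θ : Jet k => D 1 (D 1 (tay θ α))) :=
    fun α => ((h1 α).deriv 1).mono (by simp)
  have h12 : ∀ α, YOrder 1 (fun θ : Jet k => D 1 (D 2 (tay θ α))) :=
    fun α => ((h2 α).deriv 1).mono (by simp)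
  fin_cases i
  · exact ((h01 0).add (((h1 0).mul (h2 0)).add ((h0 0).mul (h12 0)))).add
      (((h1 1).mul (h1 0)).add ((h0 1).mul (h11 0)))
  · exact (((h01 1).add (((h1 1).mul (h1 1)).add ((h0 1).mul (h11 1)))).sub
      (((h1 0).mul (h2 1)).add ((h0 0).mul (h12 1)))).add
      ((((h2 0).mul (h1 1)).add ((h2 0).mul (h1 1))).add
        (((h0 0).mul (h12 1)).add ((h0 0).mul (h12 1))))

theorem coord_jetOf (s : Fin 2 → Sm) (z : Base) (α : Fin 2) (a b c : ℕ)
    (h : ∑ i, ![a, b, c] i ≤ 2) :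
    coord (jetOf 2 (fun α => (s α : Base → ℝ)) z) α a b c h = ev z (Dm ![a, b, c] (s α)) := by
  rw [← pderivs_eq_ev]; rfl

theorem Dm_vec (a b c : ℕ) (f : Sm) :
    Dm ![a, b, c] f = (D 0)^[a] ((D 1)^[b] ((D 2)^[c] f)) := by
  simp only [Dm, Module.End.mul_apply, Module.End.pow_apply]
  rfl

/-- The system evaluated on a section. -/
theorem F_jetOf (s : Fin 2 → Sm) (i : Fin 2) :
    (fun z => F i (jetOf 2 (fun α => (s α : Base → ℝ)) z))
      = ((rhsS s i - D 2 (D 2 (s i)) : Sm) : Base → ℝ) := by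
  funext z
  rw [← ev_apply z]
  fin_cases i
  · simp [F, F₁, coord_jetOf, Dm_vec, rhsS]
  · simp [F, F₂, coord_jetOf, Dm_vec, rhsS]
    ring

theorem mem_MS_iff {k : ℕ} (θ : Jet k) :
    θ ∈ MS k ↔ ∀ (i : Fin 2) (τ : Fin 3 → ℕ) (h : ∑ j, (τ + Pi.single 2 2 : Fin 3 → ℕ) j ≤ k),
      θ.2 (i, ⟨τ + Pi.single 2 2, h⟩) = ev θ.1 (Dm τ (rhsS (tay θ) i)) := by
  have hsum : ∀ τ : Fin 3 → ℕ, ∑ j, (τ + Pi.single 2 2 : Fin 3 → ℕ) j = ∑ j, τ j + 2 := by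
    intro τ; simp [Finset.sum_add_distrib]
  have key : ∀ (i : Fin 2) (τ : Fin 3 → ℕ) (h : ∑ j, (τ + Pi.single 2 2 : Fin 3 → ℕ) j ≤ k),
      pderivs τ (fun z => F i (jetOf 2 (taylor θ) z)) θ.1
        = ev θ.1 (Dm τ (rhsS (tay θ) i)) - θ.2 (i, ⟨τ + Pi.single 2 2, h⟩) := by
    intro i τ h
    have h1 : taylor θ = fun α => (tay θ α : Base → ℝ) := funext fun α => (coe_tay θ α).symm
    rw [h1, F_jetOf, pderivs_eq_ev, map_sub, map_sub, Dm_D, Dm_D, add_assoc, ← Pi.single_add,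
      ev_Dm_tay, dif_pos h]
  refine forall_congr' fun i => forall_congr' fun τ => ⟨fun H h => ?_, fun H h => ?_⟩
  · have := H (by rw [← hsum]; exact h)
    rw [key i τ h] at this
    linarith
  · have h' := h
    rw [← hsum] at h'
    rw [key i τ h', H h', sub_self]

/-- One step of the reconstruction of a point of `MS k` from its jet variables with `σ_y ≤ 1`. -/
def reconstruct {k : ℕ} (θ : Jet k) : Jet k :=
  (θ.1, fun q => if 2 ≤ q.2.1 2 then ev θ.1 (Dm (q.2.1 - Pi.single 2 2) (rhsS (tay θ) q.1))
    else θ.2 q)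

theorem mem_MS_iff_reconstruct {k : ℕ} (θ : Jet k) : θ ∈ MS k ↔ reconstruct θ = θ := by
  rw [mem_MS_iff]
  constructor
  · intro H
    refine Prod.ext rfl (funext fun q => ?_)
    obtain ⟨i, σ, hσ⟩ := q
    simp only [reconstruct]
    split_ifs with h2
    · have : σ = (σ - Pi.single 2 2) + Pi.single 2 2 :=
        (tsub_add_cancel_of_le fun j => by
          by_cases hj : j = 2
          · subst hj; simpa using h2
          · simp [hj]).symm
      rw [← H i _ (this ▸ hσ)]
      exact congrArg θ.2 (Prod.ext rfl (Subtype.ext this.symm))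
    · rfl
  · intro H i τ h
    have := congrFun (congrArg Prod.snd H) (i, ⟨τ + Pi.single 2 2, h⟩)
    simpa [reconstruct] using this.symm

theorem continuous_reconstruct (k : ℕ) : Continuous (reconstruct (k := k)) := by
  refine continuous_fst.prodMk (continuous_pi fun q => ?_)
  by_cases h : 2 ≤ q.2.1 2
  · simp only [h, if_true]
    exact (yOrder_rhsS k q.1 _).1
  · simp only [h, if_false]
    fun_prop

/-- A recomputed entry of `y`-order `σ_y` uses only entries of `y`-order at most `σ_y - 1`, so each
step gains one layer of agreement. -/
theorem reconstruct_congr {k n : ℕ} {θ θ' : Jet k} (h0 : θ.1 = θ'.1)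
    (hfree : ∀ q : Fin 2 × MultiIndex k, q.2.1 2 ≤ 1 → θ.2 q = θ'.2 q)
    (h : ∀ q : Fin 2 × MultiIndex k, q.2.1 2 ≤ n → θ.2 q = θ'.2 q) :
    ∀ q : Fin 2 × MultiIndex k, q.2.1 2 ≤ n + 1 → (reconstruct θ).2 q = (reconstruct θ').2 q := by
  intro q hq
  simp only [reconstruct]
  split_ifs with h2
  · refine (yOrder_rhsS k q.1 _).2 θ θ' h0 fun p hp => h p (hp.trans ?_)
    simp only [Pi.sub_apply, Pi.single_eq_same]
    omega
  · exact hfree q (by omega)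

theorem iterate_reconstruct_free {k : ℕ} (n : ℕ) (θ : Jet k) :
    (reconstruct^[n] θ).1 = θ.1 ∧
      ∀ q : Fin 2 × MultiIndex k, q.2.1 2 ≤ 1 → (reconstruct^[n] θ).2 q = θ.2 q := by
  induction n with
  | zero => exact ⟨rfl, fun _ _ => rfl⟩
  | succ n ih =>
    rw [Function.iterate_succ_apply']
    refine ⟨ih.1, fun q hq => ?_⟩
    rw [← ih.2 q hq]
    simp only [reconstruct]
    rw [if_neg (by omega)]

theorem iterate_reconstruct_stable {k : ℕ} (n : ℕ) (θ : Jet k) :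
    ∀ q : Fin 2 × MultiIndex k, q.2.1 2 ≤ n →
      (reconstruct^[n + 1] θ).2 q = (reconstruct^[n] θ).2 q := by
  induction n with
  | zero =>
    intro q hq
    rw [(iterate_reconstruct_free _ θ).2 q (by omega), (iterate_reconstruct_free _ θ).2 q (by omega)]
  | succ n ih =>
    rw [Function.iterate_succ_apply' _ (n + 1), Function.iterate_succ_apply' _ n]
    rw [Function.iterate_succ_apply' _ n] at ih
    have h1 := iterate_reconstruct_free (n + 1) θ
    have h0 := iterate_reconstruct_free n θ
    rw [Function.iterate_succ_apply' _ n] at h1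
    exact reconstruct_congr (h1.1.trans h0.1.symm) (fun q hq => (h1.2 q hq).trans (h0.2 q hq).symm)
      ih

/-- Since `σ_y ≤ |σ| ≤ k`, after `k` steps every layer has stabilized. -/
theorem iterate_reconstruct_mem {k : ℕ} (θ : Jet k) : reconstruct^[k] θ ∈ MS k := by
  rw [mem_MS_iff_reconstruct]
  refine Prod.ext rfl (funext fun q => ?_)
  rw [← Function.iterate_succ_apply' reconstruct]
  refine iterate_reconstruct_stable k θ q (le_trans ?_ q.2.2)
  exact Finset.single_le_sum (f := q.2.1) (fun _ _ => Nat.zero_le _) (Finset.mem_univ 2)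

/-- Finitely many jet variables with `σ_y ≤ 1` can be made non-zero by arbitrarily small
perturbations inside `MS k`. -/
theorem subset_closure_ne_zero {k : ℕ} (S : Set (Fin 2 × MultiIndex k))
    (hS : ∀ q ∈ S, q.2.1 2 ≤ 1) :
    MS k ⊆ closure {θ | θ ∈ MS k ∧ ∀ q ∈ S, θ.2 q ≠ 0} := by
  intro θ hθ
  -- Shift all jet variables by `ε` and project back to `MS k`. The projection leaves the variables
  -- with `σ_y ≤ 1` untouched, so these are exactly `θ.2 q + ε`, nonzero for small `ε ≠ 0`.
  let path : ℝ → Jet k := fun ε => reconstruct^[k] (θ.1, fun q => θ.2 q + ε)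
  have hc : Continuous path :=
    ((continuous_reconstruct k).iterate k).comp (by fun_prop)
  have h0 : path 0 = θ := by
    simp only [path, add_zero]
    exact Function.iterate_fixed ((mem_MS_iff_reconstruct θ).1 hθ) k
  have hev : ∀ᶠ ε in nhdsWithin (0 : ℝ) {0}ᶜ,
      path ε ∈ {θ | θ ∈ MS k ∧ ∀ q ∈ S, θ.2 q ≠ 0} := by
    have h1 : ∀ q : Fin 2 × MultiIndex k, ∀ᶠ ε in nhdsWithin (0 : ℝ) {0}ᶜ, θ.2 q + ε ≠ 0 := by
      intro q
      by_cases hq : θ.2 q = 0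
      · filter_upwards [self_mem_nhdsWithin] with ε hε
        simpa [hq] using hε
      · refine Filter.Eventually.filter_mono nhdsWithin_le_nhds ?_
        have : ContinuousAt (fun ε : ℝ => θ.2 q + ε) 0 := by fun_prop
        exact this.eventually_ne (by simpa using hq)
    filter_upwards [Filter.eventually_all.2 h1] with ε hε
    refine ⟨iterate_reconstruct_mem _, fun q hq => ?_⟩
    rw [(iterate_reconstruct_free k _).2 q (hS q hq)]
    exact hε q
  refine mem_closure_of_tendsto ?_ hev
  have := (hc.tendsto 0).mono_left (nhdsWithin_le_nhds (s := {0}ᶜ))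
  rwa [h0] at this

/-! ### The explicit symmetries. -/

/-- The point vector field with base components `h`, and fibre components determined by `h`. -/
def field (h : Fin 3 → Sm) : Total → Total := fun p =>
  (fun i => ev p.1 (h i),
    ![ev p.1 (D 0 (h 2)) + p.2 0 * ev p.1 (D 2 (h 2) - D 0 (h 0)) - 2 * ev p.1 (D 2 (h 1)),
      ev p.1 (D 0 (h 1)) + 2 * p.2 1 * ev p.1 (D 2 (h 2) - D 0 (h 0))
        + p.2 0 * ev p.1 (D 2 (h 1))])

/-- The restriction of the fibre components of `field h` to the section `s`. -/
def fibS (h : Fin 3 → Sm) (s : Fin 2 → Sm) : Fin 2 → Sm :=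
  ![D 0 (h 2) + s 0 * (D 2 (h 2) - D 0 (h 0)) - (D 2 (h 1) + D 2 (h 1)),
    D 0 (h 1) + (s 1 + s 1) * (D 2 (h 2) - D 0 (h 0)) + s 0 * D 2 (h 1)]

/-- The generating section of `field h` along the section `s`. -/
def genS (h : Fin 3 → Sm) (s : Fin 2 → Sm) (α : Fin 2) : Sm :=
  fibS h s α - (h 0 * D 0 (s α) + h 1 * D 1 (s α) + h 2 * D 2 (s α))

theorem field_snd (h : Fin 3 → Sm) (s : Fin 2 → Sm) (z : Base) (α : Fin 2) :
    (field h (z, fun β => (s β : Base → ℝ) z)).2 α = ev z (fibS h s α) := by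
  fin_cases α
  · simp [field, fibS, ← ev_apply]
    ring
  · simp [field, fibS, ← ev_apply]
    left
    ring

theorem genSection_field (h : Fin 3 → Sm) (s : Fin 2 → Sm) (α : Fin 2) :
    genSection (field h) (fun α => (s α : Base → ℝ)) α = (genS h s α : Base → ℝ) := by
  funext z
  rw [← ev_apply z, genS, map_sub, ← field_snd]
  simp only [genSection, Fin.sum_univ_three, map_add, map_mul, field]
  rfl

theorem taylor_eq {k : ℕ} (θ : Jet k) : taylor θ = fun α => (tay θ α : Base → ℝ) :=
  funext fun α => (coe_tay θ α).symm

/-- The prolongation of `field h` along the section `s`, as a smooth function. -/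
def proS (h : Fin 3 → Sm) (s : Fin 2 → Sm) (α : Fin 2) (σ : Fin 3 → ℕ) : Sm :=
  Dm σ (genS h s α) + (h 0 * Dm σ (D 0 (s α)) + h 1 * Dm σ (D 1 (s α)) + h 2 * Dm σ (D 2 (s α)))

theorem prolong_field_snd {k : ℕ} (h : Fin 3 → Sm) (θ : Jet k) (p : Fin 2 × MultiIndex k) :
    (prolong k (field h) θ).2 p = ev θ.1 (proS h (tay θ) p.1 p.2.1) := by
  simp only [prolong, taylor_eq, genSection_field, pderivs_eq_ev, proS, map_add, map_mul, Dm_D,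
    Fin.sum_univ_three]
  rfl

theorem coord_eq_ev (θ : Jet 2) (α : Fin 2) (a b c : ℕ) (h : ∑ i, ![a, b, c] i ≤ 2) :
    coord θ α a b c h = ev θ.1 (Dm ![a, b, c] (tay θ α)) := by
  rw [ev_Dm_tay, dif_pos h]; rfl

/-- The jet variables as continuous linear functionals. -/
def coordL (α : Fin 2) (a b c : ℕ) (h : ∑ i, ![a, b, c] i ≤ 2) : Jet 2 →L[ℝ] ℝ :=
  (ContinuousLinearMap.proj (R := ℝ) (φ := fun _ : Fin 2 × MultiIndex 2 => ℝ)
    (α, ⟨![a, b, c], h⟩)).comp (ContinuousLinearMap.snd ℝ Base (Fin 2 × MultiIndex 2 → ℝ))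

theorem hasFDerivAt_coord (α : Fin 2) (a b c : ℕ) (h : ∑ i, ![a, b, c] i ≤ 2) (θ : Jet 2) :
    HasFDerivAt (fun θ => coord θ α a b c h) (coordL α a b c h) θ :=
  (coordL α a b c h).hasFDerivAt

theorem coordL_apply (α : Fin 2) (a b c : ℕ) (h : ∑ i, ![a, b, c] i ≤ 2) (w : Jet 2) :
    coordL α a b c h w = coord w α a b c h := rfl

theorem fderiv_F₁ (θ w : Jet 2) : fderiv ℝ F₁ θ w =
    coord w 0 1 1 0
    + (coord w 0 0 1 0 * coord θ 0 0 0 1 + coord θ 0 0 1 0 * coord w 0 0 0 1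
      + (coord w 0 0 0 0 * coord θ 0 0 1 1 + coord θ 0 0 0 0 * coord w 0 0 1 1))
    + (coord w 1 0 1 0 * coord θ 0 0 1 0 + coord θ 1 0 1 0 * coord w 0 0 1 0
      + (coord w 1 0 0 0 * coord θ 0 0 2 0 + coord θ 1 0 0 0 * coord w 0 0 2 0))
    - coord w 0 0 0 2 := by
  have H := fun α a b c h => hasFDerivAt_coord α a b c h θ
  have := (((H 0 1 1 0 (by decide)).add
    (((H 0 0 1 0 (by decide)).mul (H 0 0 0 1 (by decide))).add
      ((H 0 0 0 0 (by decide)).mul (H 0 0 1 1 (by decide))))).add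
    (((H 1 0 1 0 (by decide)).mul (H 0 0 1 0 (by decide))).add
      ((H 1 0 0 0 (by decide)).mul (H 0 0 2 0 (by decide))))).sub (H 0 0 0 2 (by decide))
  have h2 : fderiv ℝ F₁ θ = _ := this.fderiv
  rw [h2]
  simp [coordL_apply]
  ring

theorem fderiv_F₂ (θ w : Jet 2) : fderiv ℝ F₂ θ w =
    coord w 1 1 1 0
    + (coord w 1 0 1 0 * coord θ 1 0 1 0 + coord θ 1 0 1 0 * coord w 1 0 1 0
      + (coord w 1 0 0 0 * coord θ 1 0 2 0 + coord θ 1 0 0 0 * coord w 1 0 2 0))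
    - (coord w 0 0 1 0 * coord θ 1 0 0 1 + coord θ 0 0 1 0 * coord w 1 0 0 1
      + (coord w 0 0 0 0 * coord θ 1 0 1 1 + coord θ 0 0 0 0 * coord w 1 0 1 1))
    - (coord w 1 0 0 2
      - 2 * (coord w 0 0 0 1 * coord θ 1 0 1 0 + coord θ 0 0 0 1 * coord w 1 0 1 0
        + (coord w 0 0 0 0 * coord θ 1 0 1 1 + coord θ 0 0 0 0 * coord w 1 0 1 1))) := by
  have H := fun α a b c h => hasFDerivAt_coord α a b c h θ
  have := (((H 1 1 1 0 (by decide)).add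
    (((H 1 0 1 0 (by decide)).mul (H 1 0 1 0 (by decide))).add
      ((H 1 0 0 0 (by decide)).mul (H 1 0 2 0 (by decide))))).sub
    (((H 0 0 1 0 (by decide)).mul (H 1 0 0 1 (by decide))).add
      ((H 0 0 0 0 (by decide)).mul (H 1 0 1 1 (by decide))))).sub
    ((H 1 0 0 2 (by decide)).sub
      ((((H 0 0 0 1 (by decide)).mul (H 1 0 1 0 (by decide))).add
      ((H 0 0 0 0 (by decide)).mul (H 1 0 1 1 (by decide)))).const_mul 2))
  have h2 : fderiv ℝ F₂ θ = _ := this.fderiv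
  rw [h2]
  simp [coordL_apply]
  ring

/-- The determining equations for the base components of a symmetry. -/
def symAlg : Submodule ℝ (Fin 3 → Sm) where
  carrier := {h | D 1 (h 0) = 0 ∧ D 2 (h 0) = 0 ∧ D 1 (h 2) = 0 ∧
    D 1 (h 1) = D 2 (h 2) + D 2 (h 2) - D 0 (h 0) ∧ D 2 (D 2 (h 2)) = 0 ∧
    D 2 (D 2 (h 1)) = D 0 (D 2 (h 2)) + D 0 (D 2 (h 2)) - D 0 (D 0 (h 0))}
  add_mem' := by
    rintro f g ⟨f1, f2, f3, f4, f5, f6⟩ ⟨g1, g2, g3, g4, g5, g6⟩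
    refine ⟨?_, ?_, ?_, ?_, ?_, ?_⟩ <;> simp only [Pi.add_apply, map_add, *] <;> abel
  zero_mem' := by simp
  smul_mem' := by
    rintro c f ⟨f1, f2, f3, f4, f5, f6⟩
    refine ⟨?_, ?_, ?_, ?_, ?_, ?_⟩ <;>
      simp only [Pi.smul_apply, Derivation.map_smul, smul_add, smul_sub, smul_zero, *]

/-- The section is arbitrary: the linearization is a multiple of the system even off the equation,
hence vanishes on it. -/
theorem linearized_F₁ {h : Fin 3 → Sm} (hh : h ∈ symAlg) (s : Fin 2 → Sm) :
    proS h s 0 ![1, 1, 0]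
    + (proS h s 0 ![0, 1, 0] * D 2 (s 0) + D 1 (s 0) * proS h s 0 ![0, 0, 1]
      + (proS h s 0 ![0, 0, 0] * D 1 (D 2 (s 0)) + s 0 * proS h s 0 ![0, 1, 1]))
    + (proS h s 1 ![0, 1, 0] * D 1 (s 0) + D 1 (s 1) * proS h s 0 ![0, 1, 0]
      + (proS h s 1 ![0, 0, 0] * D 1 (D 1 (s 0)) + s 1 * proS h s 0 ![0, 2, 0]))
    - proS h s 0 ![0, 0, 2]
    = - (D 0 (h 0) + D 2 (h 2)) * (rhsS s 0 - D 2 (D 2 (s 0))) := by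
  obtain ⟨h1, h2, h3, h4, h5, h6⟩ := hh
  have h7 : D 1 (D 2 (h 2)) = 0 := by rw [D_comm, h3, map_zero]
  have h8 : D 1 (D 2 (h 1)) = - D 0 (D 2 (h 0)) := by
    rw [D_comm, h4, map_sub, map_add, h5, D_two_zero]; simp
  have h9 : D 0 (D 2 (h 0)) = 0 := by rw [h2, map_zero]
  rw [h9, neg_zero] at h8
  simp only [proS, genS, fibS, rhsS, Dm_vec, Function.iterate_succ, Function.iterate_zero,
    Function.comp, id, Matrix.cons_val_zero, Matrix.cons_val_one, map_add, map_sub, map_zero,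
    Derivation.leibniz, smul_eq_mul, D_one_zero, D_two_zero, D_two_one, h1, h2, h3, h4, h5, h6,
    h7, h8, mul_zero, add_zero, zero_add, sub_zero]
  ring

/-- The multiplier matrix is triangular: `∂_y h 1` mixes `v` with `u`, and so brings in the first
equation. -/
theorem linearized_F₂ {h : Fin 3 → Sm} (hh : h ∈ symAlg) (s : Fin 2 → Sm) :
    proS h s 1 ![1, 1, 0]
    + (proS h s 1 ![0, 1, 0] * D 1 (s 1) + D 1 (s 1) * proS h s 1 ![0, 1, 0]
      + (proS h s 1 ![0, 0, 0] * D 1 (D 1 (s 1)) + s 1 * proS h s 1 ![0, 2, 0]))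
    - (proS h s 0 ![0, 1, 0] * D 2 (s 1) + D 1 (s 0) * proS h s 1 ![0, 0, 1]
      + (proS h s 0 ![0, 0, 0] * D 1 (D 2 (s 1)) + s 0 * proS h s 1 ![0, 1, 1]))
    - (proS h s 1 ![0, 0, 2]
      - 2 * (proS h s 0 ![0, 0, 1] * D 1 (s 1) + D 2 (s 0) * proS h s 1 ![0, 1, 0]
        + (proS h s 0 ![0, 0, 0] * D 1 (D 2 (s 1)) + s 0 * proS h s 1 ![0, 1, 1])))
    = - (D 0 (h 0) + D 0 (h 0)) * (rhsS s 1 - D 2 (D 2 (s 1)))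
      + D 2 (h 1) * (rhsS s 0 - D 2 (D 2 (s 0))) := by
  obtain ⟨h1, h2, h3, h4, h5, h6⟩ := hh
  have h7 : D 1 (D 2 (h 2)) = 0 := by rw [D_comm, h3, map_zero]
  have h8 : D 1 (D 2 (h 1)) = - D 0 (D 2 (h 0)) := by
    rw [D_comm, h4, map_sub, map_add, h5, D_two_zero]; simp
  have h9 : D 0 (D 2 (h 0)) = 0 := by rw [h2, map_zero]
  rw [h9, neg_zero] at h8
  simp only [proS, genS, fibS, rhsS, Dm_vec, Function.iterate_succ, Function.iterate_zero,
    Function.comp, id, Matrix.cons_val_zero, Matrix.cons_val_one, map_add, map_sub, map_zero,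
    Derivation.leibniz, smul_eq_mul, D_one_zero, D_two_zero, D_two_one, h1, h2, h3, h4, h5, h6,
    h7, h8, mul_zero, add_zero, zero_add, sub_zero]
  ring

theorem F_eq_ev (θ : Jet 2) (i : Fin 2) :
    F i θ = ev θ.1 (rhsS (tay θ) i - D 2 (D 2 (tay θ i))) := by
  have h1 : jetOf 2 (fun α => (tay θ α : Base → ℝ)) θ.1 = θ := by
    refine Prod.ext rfl (funext fun q => ?_)
    change pderivs q.2.1 _ _ = _
    rw [pderivs_eq_ev, ev_Dm_tay, dif_pos q.2.2]
  rw [ev_apply, ← F_jetOf]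
  exact congrArg (F i) h1.symm

theorem coord_prolong_field (h : Fin 3 → Sm) (θ : Jet 2) (α : Fin 2) (a b c : ℕ)
    (hs : ∑ i, ![a, b, c] i ≤ 2) :
    coord (prolong 2 (field h) θ) α a b c hs = ev θ.1 (proS h (tay θ) α ![a, b, c]) :=
  prolong_field_snd h θ _

theorem contDiff_field (h : Fin 3 → Sm) : ContDiff ℝ ∞ (field h) := by
  have H : ∀ f : Sm, ContDiff ℝ ∞ fun p : Total => ev p.1 f :=
    fun f => (contDiff_coe f).comp contDiff_fst
  have Hw : ∀ α : Fin 2, ContDiff ℝ ∞ fun p : Total => p.2 α :=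
    fun α => (contDiff_apply ℝ ℝ α).comp contDiff_snd
  refine (contDiff_pi.2 fun i => H (h i)).prodMk (contDiff_pi.2 fun α => ?_)
  fin_cases α
  · exact ((H _).add ((Hw 0).mul (H _))).sub (contDiff_const.mul (H _))
  · exact ((H _).add ((contDiff_const.mul (Hw 1)).mul (H _))).add ((Hw 0).mul (H _))

theorem isSymmetry_field {h : Fin 3 → Sm} (hh : h ∈ symAlg) : IsSymmetry (field h) := by
  refine ⟨contDiff_field h, fun θ hθ i => ?_⟩
  have e0 := hθ 0
  have e1 := hθ 1
  rw [F_eq_ev] at e0 e1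
  fin_cases i
  · have := congrArg (ev θ.1) (linearized_F₁ hh (tay θ))
    change fderiv ℝ F₁ θ _ = 0
    rw [map_mul, e0, mul_zero] at this
    rw [fderiv_F₁, ← this]
    simp only [coord_prolong_field]
    simp [coord_eq_ev, Dm_vec]
  · have := congrArg (ev θ.1) (linearized_F₂ hh (tay θ))
    change fderiv ℝ F₂ θ _ = 0
    rw [map_add, map_mul, map_mul, e0, e1, mul_zero, mul_zero, add_zero] at this
    rw [fderiv_F₂, ← this]
    simp only [coord_prolong_field]
    simp [coord_eq_ev, Dm_vec, map_ofNat]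

/-! ### Chain rule along sections and 2-jets with prescribed coordinates. -/

/-- The restriction of a smooth function on the total space to the section `s`. -/
def res (f : {f : Total → ℝ // ContDiff ℝ ∞ f}) (s : Fin 2 → Sm) : Sm :=
  ⟨fun z => f.1 (z, fun β => (s β : Base → ℝ) z),
    (f.2.comp (contDiff_id.prodMk (contDiff_pi.2 fun β => contDiff_coe (s β))) :
      ContDiff ℝ ∞ (f.1 ∘ fun z : Base => (z, fun β => (s β : Base → ℝ) z)))⟩

/-- The lift of the `i`-th coordinate vector along the section `s`. -/
def lift (s : Fin 2 → Sm) (i : Fin 3) (z : Base) : Total :=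
  (Pi.single i 1, fun β => (D i (s β) : Base → ℝ) z)

/-- The graph of the section `s`. -/
def graph (s : Fin 2 → Sm) (z : Base) : Total := (z, fun β => (s β : Base → ℝ) z)

theorem hasFDerivAt_graph (s : Fin 2 → Sm) (z : Base) :
    HasFDerivAt (graph s) ((ContinuousLinearMap.id ℝ Base).prod
      (ContinuousLinearMap.pi fun β => fderiv ℝ (s β : Base → ℝ) z)) z :=
  (hasFDerivAt_id z).prodMk
    (hasFDerivAt_pi.2 fun β => (differentiableAt_coe (s β) z).hasFDerivAt)

theorem D_res (f : {f : Total → ℝ // ContDiff ℝ ∞ f}) (s : Fin 2 → Sm) (i : Fin 3) (z : Base) :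
    (D i (res f s) : Base → ℝ) z = fderiv ℝ f.1 (graph s z) (lift s i z) := by
  have h1 : HasFDerivAt f.1 (fderiv ℝ f.1 (graph s z)) (graph s z) :=
    ((f.2.differentiable (by simp)) _).hasFDerivAt
  have h2 := (h1.comp z (hasFDerivAt_graph s z)).fderiv
  change fderiv ℝ (f.1 ∘ graph s) z (Pi.single i 1) = _
  rw [h2]
  rfl

theorem D_D_res (f : {f : Total → ℝ // ContDiff ℝ ∞ f}) (s : Fin 2 → Sm) (i j : Fin 3)
    (z : Base) : (D i (D j (res f s)) : Base → ℝ) z =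
      fderiv ℝ (fderiv ℝ f.1) (graph s z) (lift s i z) (lift s j z)
        + fderiv ℝ f.1 (graph s z) (0, fun β => (D i (D j (s β)) : Base → ℝ) z) := by
  have h1 : HasFDerivAt (fderiv ℝ f.1) (fderiv ℝ (fderiv ℝ f.1) (graph s z)) (graph s z) :=
    (((f.2.fderiv_right (m := ∞) (by simp)).differentiable (by simp)) _).hasFDerivAt
  have h2 := h1.comp z (hasFDerivAt_graph s z)
  have h3 : HasFDerivAt (lift s j) ((0 : Base →L[ℝ] Base).prod
      (ContinuousLinearMap.pi fun β => fderiv ℝ (D j (s β) : Base → ℝ) z)) z :=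
    (hasFDerivAt_const (Pi.single j 1 : Base) z).prodMk
      (hasFDerivAt_pi.2 fun β => (differentiableAt_coe (D j (s β)) z).hasFDerivAt)
  have h4 := (h2.clm_apply h3).fderiv
  have h5 : (D j (res f s) : Base → ℝ)
      = fun z => ((fderiv ℝ f.1 ∘ graph s) z) (lift s j z) := funext fun z => D_res f s j z
  change fderiv ℝ (D j (res f s) : Base → ℝ) z (Pi.single i 1) = _
  rw [h5, h4, add_comm]
  rfl

/-- The components of a smooth vector field. -/
def compB {X : Total → Total} (hX : ContDiff ℝ ∞ X) (l : Fin 3) :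
    {f : Total → ℝ // ContDiff ℝ ∞ f} :=
  ⟨fun p => (X p).1 l, contDiff_pi.1 (contDiff_fst.comp hX) l⟩

/-- The fibre components of a smooth vector field. -/
def compF {X : Total → Total} (hX : ContDiff ℝ ∞ X) (α : Fin 2) :
    {f : Total → ℝ // ContDiff ℝ ∞ f} :=
  ⟨fun p => (X p).2 α, contDiff_pi.1 (contDiff_snd.comp hX) α⟩

/-- The coefficient `D_σ φ + ∑ i, Y i u_{σ i}` of a prolonged vector field. -/
def prS (Y : Fin 3 → Sm) (Φ f : Sm) (σ : Fin 3 → ℕ) : Sm :=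
  Dm σ (Φ - (Y 0 * D 0 f + Y 1 * D 1 f + Y 2 * D 2 f))
    + (Y 0 * Dm σ (D 0 f) + Y 1 * Dm σ (D 1 f) + Y 2 * Dm σ (D 2 f))

theorem coord_prolong {X : Total → Total} (hX : ContDiff ℝ ∞ X) (θ : Jet 2) (α : Fin 2)
    (a b c : ℕ) (hs : ∑ i, ![a, b, c] i ≤ 2) :
    coord (prolong 2 X θ) α a b c hs
      = ev θ.1 (prS (fun l => res (compB hX l) (tay θ)) (res (compF hX α) (tay θ)) (tay θ α)
        ![a, b, c]) := by
  have hg : genSection X (fun α => (tay θ α : Base → ℝ)) α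
      = ((res (compF hX α) (tay θ) - (res (compB hX 0) (tay θ) * D 0 (tay θ α)
        + res (compB hX 1) (tay θ) * D 1 (tay θ α)
        + res (compB hX 2) (tay θ) * D 2 (tay θ α)) : Sm) : Base → ℝ) := by
    funext z
    simp only [genSection, Fin.sum_univ_three]
    rfl
  have ht : ∀ l, (X (toTotal θ)).1 l = ev θ.1 (res (compB hX l) (tay θ)) := by
    intro l
    have : toTotal θ = graph (tay θ) θ.1 := by
      refine Prod.ext rfl (funext fun β => ?_)
      change _ = ev θ.1 (Dm 0 (tay θ β))
      rw [ev_Dm_tay, dif_pos (by simp)]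
      rfl
    rw [this]; rfl
  change pderivs _ (genSection X (taylor θ) α) θ.1
    + ∑ i, (X (toTotal θ)).1 i * pderivs (![a, b, c] + Pi.single i 1) (taylor θ α) θ.1 = _
  rw [taylor_eq, hg, pderivs_eq_ev]
  simp only [pderivs_eq_ev, ht, ← Dm_D, Fin.sum_univ_three, prS, map_add, map_mul]

/-- The second order jet with prescribed jet variables. -/
def twoJet (x : Base) (w : Fin 2 → ℝ) (m : Fin 3 → Fin 2 → ℝ) (n : Fin 3 → Fin 3 → Fin 2 → ℝ) :
    Jet 2 :=
  (x, fun q => match q.2.1 0, q.2.1 1, q.2.1 2 with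
    | 0, 0, 0 => w q.1
    | 1, 0, 0 => m 0 q.1
    | 0, 1, 0 => m 1 q.1
    | 0, 0, 1 => m 2 q.1
    | 2, 0, 0 => n 0 0 q.1
    | 1, 1, 0 => n 0 1 q.1
    | 1, 0, 1 => n 0 2 q.1
    | 0, 2, 0 => n 1 1 q.1
    | 0, 1, 1 => n 1 2 q.1
    | 0, 0, 2 => n 2 2 q.1
    | _, _, _ => 0)

section twoJet
variable (x : Base) (w : Fin 2 → ℝ) (m : Fin 3 → Fin 2 → ℝ) (n : Fin 3 → Fin 3 → Fin 2 → ℝ)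

theorem twoJet_fst : (twoJet x w m n).1 = x := rfl

theorem coe_tay_twoJet (α : Fin 2) : (tay (twoJet x w m n) α : Base → ℝ) x = w α := by
  have := ev_Dm_tay (twoJet x w m n) α ![0, 0, 0]
  rw [dif_pos (by decide), Dm_vec] at this
  exact this

theorem coe_D_tay_twoJet (α : Fin 2) (i : Fin 3) :
    (D i (tay (twoJet x w m n) α) : Base → ℝ) x = m i α := by
  have h0 := ev_Dm_tay (twoJet x w m n) α ![1, 0, 0]
  have h1 := ev_Dm_tay (twoJet x w m n) α ![0, 1, 0]
  have h2 := ev_Dm_tay (twoJet x w m n) α ![0, 0, 1]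
  rw [dif_pos (by decide), Dm_vec] at h0 h1 h2
  fin_cases i
  exacts [h0, h1, h2]

theorem coe_D_D_tay_twoJet (α : Fin 2) (i j : Fin 3) (hij : i ≤ j) :
    (D i (D j (tay (twoJet x w m n) α)) : Base → ℝ) x = n i j α := by
  have h0 := ev_Dm_tay (twoJet x w m n) α ![2, 0, 0]
  have h1 := ev_Dm_tay (twoJet x w m n) α ![1, 1, 0]
  have h2 := ev_Dm_tay (twoJet x w m n) α ![1, 0, 1]
  have h3 := ev_Dm_tay (twoJet x w m n) α ![0, 2, 0]
  have h4 := ev_Dm_tay (twoJet x w m n) α ![0, 1, 1]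
  have h5 := ev_Dm_tay (twoJet x w m n) α ![0, 0, 2]
  rw [dif_pos (by decide), Dm_vec] at h0 h1 h2 h3 h4 h5
  fin_cases i <;> fin_cases j <;> first | exact absurd hij (by decide) | skip
  exacts [h0, h1, h2, h3, h4, h5]

theorem F_twoJet : (∀ i, F i (twoJet x w m n) = 0) ↔
    (n 2 2 0 = n 0 1 0 + m 1 0 * m 2 0 + w 0 * n 1 2 0 + m 1 1 * m 1 0 + w 1 * n 1 1 0 ∧
    n 2 2 1 = n 0 1 1 + m 1 1 * m 1 1 + w 1 * n 1 1 1 - m 1 0 * m 2 1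
      + w 0 * n 1 2 1 + 2 * m 2 0 * m 1 1) := by
  rw [Fin.forall_fin_two]
  refine and_congr ?_ ?_
  · change n 0 1 0 + (m 1 0 * m 2 0 + w 0 * n 1 2 0) + (m 1 1 * m 1 0 + w 1 * n 1 1 0) - n 2 2 0
      = 0 ↔ _
    constructor <;> intro h <;> linarith
  · change n 0 1 1 + (m 1 1 * m 1 1 + w 1 * n 1 1 1) - (m 1 0 * m 2 1 + w 0 * n 1 2 1)
      - (n 2 2 1 - 2 * (m 2 0 * m 1 1 + w 0 * n 1 2 1)) = 0 ↔ _
    constructor <;> intro h <;> linarith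

end twoJet

/-- The linearization of `F₁` along a smooth vector field, in terms of restrictions to the
Taylor section. -/
theorem fderiv_F₁_prolong {X : Total → Total} (hX : ContDiff ℝ ∞ X) (θ : Jet 2)
    {Y : Fin 3 → Sm} {Φ s : Fin 2 → Sm} (hs : tay θ = s)
    (hY : ∀ l, res (compB hX l) s = Y l) (hΦ : ∀ α, res (compF hX α) s = Φ α) :
    fderiv ℝ (F 0) θ (prolong 2 X θ) = ev θ.1 (
      D 0 (D 1 (Φ 0)) - (D 0 (D 1 (Y 0)) * D 0 (s 0) + D 0 (D 1 (Y 1)) * D 1 (s 0)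
        + D 0 (D 1 (Y 2)) * D 2 (s 0))
      - (D 0 (Y 0) * D 0 (D 1 (s 0)) + D 0 (Y 1) * D 1 (D 1 (s 0)) + D 0 (Y 2) * D 1 (D 2 (s 0)))
      - (D 1 (Y 0) * D 0 (D 0 (s 0)) + D 1 (Y 1) * D 0 (D 1 (s 0)) + D 1 (Y 2) * D 0 (D 2 (s 0)))
      + (D 1 (Φ 0) - (D 1 (Y 0) * D 0 (s 0) + D 1 (Y 1) * D 1 (s 0) + D 1 (Y 2) * D 2 (s 0)))
        * (D 2 (s 0) + D 1 (s 1))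
      + D 1 (s 0) *
        (D 2 (Φ 0) - (D 2 (Y 0) * D 0 (s 0) + D 2 (Y 1) * D 1 (s 0) + D 2 (Y 2) * D 2 (s 0)))
      + Φ 0 * D 1 (D 2 (s 0))
      + s 0 * (D 1 (D 2 (Φ 0)) - (D 1 (D 2 (Y 0)) * D 0 (s 0) + D 1 (D 2 (Y 1)) * D 1 (s 0)
          + D 1 (D 2 (Y 2)) * D 2 (s 0))
        - (D 1 (Y 0) * D 0 (D 2 (s 0)) + D 1 (Y 1) * D 1 (D 2 (s 0)) + D 1 (Y 2) * D 2 (D 2 (s 0)))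
        - (D 2 (Y 0) * D 0 (D 1 (s 0)) + D 2 (Y 1) * D 1 (D 1 (s 0)) + D 2 (Y 2) * D 1 (D 2 (s 0))))
      + (D 1 (Φ 1) - (D 1 (Y 0) * D 0 (s 1) + D 1 (Y 1) * D 1 (s 1) + D 1 (Y 2) * D 2 (s 1)))
        * D 1 (s 0)
      + Φ 1 * D 1 (D 1 (s 0))
      + s 1 * (D 1 (D 1 (Φ 0)) - (D 1 (D 1 (Y 0)) * D 0 (s 0) + D 1 (D 1 (Y 1)) * D 1 (s 0)
          + D 1 (D 1 (Y 2)) * D 2 (s 0))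
        - 2 * (D 1 (Y 0) * D 0 (D 1 (s 0)) + D 1 (Y 1) * D 1 (D 1 (s 0))
          + D 1 (Y 2) * D 1 (D 2 (s 0))))
      - (D 2 (D 2 (Φ 0)) - (D 2 (D 2 (Y 0)) * D 0 (s 0) + D 2 (D 2 (Y 1)) * D 1 (s 0)
          + D 2 (D 2 (Y 2)) * D 2 (s 0))
        - 2 * (D 2 (Y 0) * D 0 (D 2 (s 0)) + D 2 (Y 1) * D 1 (D 2 (s 0))
          + D 2 (Y 2) * D 2 (D 2 (s 0))))) := by
  subst hs
  change fderiv ℝ F₁ θ _ = _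
  rw [fderiv_F₁]
  simp only [coord_prolong hX, coord_eq_ev, hY, hΦ]
  simp only [← map_mul, ← map_add, ← map_sub]
  congr 1
  simp only [prS, Dm_vec, Function.iterate_succ, Function.iterate_zero,
    Function.comp, id, map_add, map_sub, Derivation.leibniz, smul_eq_mul, D_one_zero, D_two_zero,
    D_two_one]
  ring

section
variable {X : Total → Total} (hX : ContDiff ℝ ∞ X) (x : Base) (w : Fin 2 → ℝ)
  (m : Fin 3 → Fin 2 → ℝ) (n : Fin 3 → Fin 3 → Fin 2 → ℝ)

theorem graph_twoJet : graph (tay (twoJet x w m n)) x = (x, w) :=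
  Prod.ext rfl (funext fun β => coe_tay_twoJet x w m n β)

theorem lift_twoJet (i : Fin 3) :
    lift (tay (twoJet x w m n)) i x = (Pi.single i 1, m i) :=
  Prod.ext rfl (funext fun β => coe_D_tay_twoJet x w m n β i)

theorem ev_D_res_twoJet (f : {f : Total → ℝ // ContDiff ℝ ∞ f}) (i : Fin 3) :
    ev x (D i (res f (tay (twoJet x w m n)))) = fderiv ℝ f.1 (x, w) (Pi.single i 1, m i) := by
  rw [ev_apply, D_res, graph_twoJet, lift_twoJet]

theorem ev_D_D_res_twoJet (f : {f : Total → ℝ // ContDiff ℝ ∞ f}) (i j : Fin 3) (hij : i ≤ j) :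
    ev x (D i (D j (res f (tay (twoJet x w m n)))))
      = fderiv ℝ (fderiv ℝ f.1) (x, w) (Pi.single i 1, m i) (Pi.single j 1, m j)
        + fderiv ℝ f.1 (x, w) (0, n i j) := by
  rw [ev_apply, D_D_res, graph_twoJet, lift_twoJet, lift_twoJet]
  have : (fun β => (D i (D j (tay (twoJet x w m n) β)) : Base → ℝ) x) = n i j :=
    funext fun β => coe_D_D_tay_twoJet x w m n β i j hij
  rw [this]

theorem ev_res_twoJet (f : {f : Total → ℝ // ContDiff ℝ ∞ f}) :
    ev x (res f (tay (twoJet x w m n))) = f.1 (x, w) :=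
  congrArg f.1 (graph_twoJet x w m n)

end

/-! ### Determining equations and classification of the symmetries. -/

/-- The part of the determining equation of order two in the jet variables: it is linear in a
second order variation `d` of the jet of `u` that is compatible with the equation. -/
theorem second_order_determining {X : Total → Total} (hX : IsSymmetry X) (x : Base)
    (w : Fin 2 → ℝ) (m : Fin 3 → Fin 2 → ℝ) (d : Fin 3 → Fin 3 → ℝ)
    (hd : d 2 2 = d 0 1 + w 0 * d 1 2 + w 1 * d 1 1)
    {T : Fin 3 → Fin 3 → ℝ} (hT : T = fun i l =>
      fderiv ℝ (compB hX.1 l).1 (x, w) (Pi.single i 1, m i)) :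
    (X (x, w)).2 0 * d 1 2 + (X (x, w)).2 1 * d 1 1
      - (T 0 0 * d 0 1 + T 0 1 * d 1 1 + T 0 2 * d 1 2)
      - (T 1 0 * d 0 0 + T 1 1 * d 0 1 + T 1 2 * d 0 2)
      - w 0 * (T 1 0 * d 0 2 + T 1 1 * d 1 2 + T 1 2 * d 2 2)
      - w 0 * (T 2 0 * d 0 1 + T 2 1 * d 1 1 + T 2 2 * d 1 2)
      - 2 * w 1 * (T 1 0 * d 0 1 + T 1 1 * d 1 1 + T 1 2 * d 1 2)
      + 2 * (T 2 0 * d 0 2 + T 2 1 * d 1 2 + T 2 2 * d 2 2) = 0 := by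
  obtain ⟨hs, hsym⟩ := hX
  let N : Fin 2 → ℝ := ![m 1 0 * m 2 0 + m 1 1 * m 1 0,
    m 1 1 * m 1 1 - m 1 0 * m 2 1 + 2 * m 2 0 * m 1 1]
  -- Two jets on the equation with the same first-order part: in `n₀` only `u_yy, v_yy` are nonzero,
  -- with the forced values `N`; `n₁` adds `d` to the second derivatives of `u`. Subtracting the two
  -- conditions leaves the part linear in `d`.
  let n₀ : Fin 3 → Fin 3 → Fin 2 → ℝ := fun i j => if i = 2 ∧ j = 2 then N else 0
  let n₁ : Fin 3 → Fin 3 → Fin 2 → ℝ := fun i j => n₀ i j + d i j • Pi.single 0 1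
  have e₀ := hsym (twoJet x w m n₀) ((F_twoJet x w m n₀).2 (by simp [n₀, N])) 0
  have e₁ := hsym (twoJet x w m n₁) ((F_twoJet x w m n₁).2
    (by simp [n₁, n₀, N, hd]; ring)) 0
  rw [fderiv_F₁_prolong hs _ rfl (fun _ => rfl) (fun _ => rfl)] at e₀ e₁
  have hc : ∀ n α, ev x (tay (twoJet x w m n) α) = w α := fun n => coe_tay_twoJet x w m n
  have hD : ∀ n α i, ev x (D i (tay (twoJet x w m n) α)) = m i α :=
    fun n => coe_D_tay_twoJet x w m n
  have hDD : ∀ n α (i j : Fin 3), i ≤ j → ev x (D i (D j (tay (twoJet x w m n) α))) = n i j α :=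
    fun n => coe_D_D_tay_twoJet x w m n
  have l01 : (0 : Fin 3) ≤ 1 := by decide
  have l02 : (0 : Fin 3) ≤ 2 := by decide
  have l12 : (1 : Fin 3) ≤ 2 := by decide
  simp only [twoJet_fst, map_sub, map_add, map_mul, map_ofNat, hc, hD, hDD _ _ _ _ (le_refl _),
    hDD _ _ _ _ l01, hDD _ _ _ _ l02, hDD _ _ _ _ l12, ev_D_res_twoJet, ev_res_twoJet,
    ev_D_D_res_twoJet _ _ _ _ _ _ _ (le_refl _), ev_D_D_res_twoJet _ _ _ _ _ _ _ l01,
    ev_D_D_res_twoJet _ _ _ _ _ _ _ l12] at e₀ e₁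
  have hlin : ∀ (f : {f : Total → ℝ // ContDiff ℝ ∞ f}) i j,
      fderiv ℝ f.1 (x, w) (0, n₁ i j) = fderiv ℝ f.1 (x, w) (0, n₀ i j)
        + d i j * fderiv ℝ f.1 (x, w) (0, Pi.single 0 1) := by
    intro f i j
    rw [← smul_eq_mul, ← map_smul, ← map_add]
    simp [n₁]
  have hn1 : ∀ i j, n₁ i j 0 = n₀ i j 0 + d i j := by intro i j; simp [n₁]
  simp only [hlin, hn1] at e₁
  have hT' : ∀ i l, T i l = fderiv ℝ (compB hs l).1 (x, w) (Pi.single i 1, m i) := by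
    intro i l; rw [hT]
  simp only [← hT'] at e₀ e₁
  change (compF hs 0).1 (x, w) * _ + (compF hs 1).1 (x, w) * _ - _ - _ - _ - _ - _ + _ = 0
  -- The terms in which `d` meets the `u`-derivatives of the components of `X` add up to a multiple
  -- of the linearized constraint `hd`.
  linear_combination e₁ - e₀ + (fderiv ℝ (compF hs 0).1 (x, w) (0, Pi.single 0 1)
    - fderiv ℝ (compB hs 0).1 (x, w) (0, Pi.single 0 1) * m 0 0
    - fderiv ℝ (compB hs 1).1 (x, w) (0, Pi.single 0 1) * m 1 0
    - fderiv ℝ (compB hs 2).1 (x, w) (0, Pi.single 0 1) * m 2 0) * hd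

/-- First derivatives of the components of a symmetry. -/
theorem first_order_determining {X : Total → Total} (hX : IsSymmetry X) (x : Base)
    (w : Fin 2 → ℝ) {L : Fin 3 → Total →L[ℝ] ℝ}
    (hL : L = fun l => fderiv ℝ (compB hX.1 l).1 (x, w)) {e : Fin 3 → Total}
    (he : e = fun i => (Pi.single i 1, 0)) :
    (∀ l (v : Fin 2 → ℝ), L l (0, v) = 0) ∧ L 0 (e 1) = 0 ∧ L 2 (e 1) = 2 * L 0 (e 2) ∧
      L 0 (e 0) + L 1 (e 1) + w 0 * L 0 (e 2) = 2 * L 2 (e 2) - w 0 * L 2 (e 1) ∧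
      (X (x, w)).2 0 = L 2 (e 0) + w 0 * (L 1 (e 1) + w 0 * L 2 (e 1) + L 2 (e 2))
        + 2 * w 1 * L 2 (e 1) - 2 * (L 1 (e 2) + w 0 * L 2 (e 2)) ∧
      (X (x, w)).2 1 = L 1 (e 0) + w 0 * (w 1 * L 2 (e 1) + L 1 (e 2))
        + 2 * w 1 * (L 1 (e 1) - L 2 (e 2)) := by
  have hsplit : ∀ l i (v : Fin 2 → ℝ), L l (Pi.single i 1, v) = L l (e i) + L l (0, v) := by
    intro l i v
    rw [he, ← map_add]
    simp
  have key := fun (m : Fin 3 → Fin 2 → ℝ) (d : Fin 3 → Fin 3 → ℝ) hd =>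
    second_order_determining hX x w m d hd
      (T := fun i l => L l (e i) + L l (0, m i)) (by funext i l; rw [← hsplit, hL])
  have h0 : ∀ l, L l ((0 : Base), (0 : Fin 2 → ℝ)) = 0 := fun l => map_zero (L l)
  -- Taking `m 1 = v` and `m 0 = m 2 = 0` makes only the derivatives `T 1 l` depend on `v`. Each
  -- choice of `d` below isolates one of them, so its fibre part must vanish.
  have htt : ∀ v : Fin 2 → ℝ, L 0 (e 1) + L 0 (0, v) = 0 := by
    intro v
    have := key ![0, v, 0] (fun i j => if i = 0 ∧ j = 0 then 1 else 0) (by simp)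
    simp at this
    linarith
  have hA1 : L 0 (e 1) = 0 := by simpa [h0] using htt 0
  have hA : ∀ v : Fin 2 → ℝ, L 0 (0, v) = 0 := fun v => by simpa [hA1] using htt v
  have hty : ∀ v : Fin 2 → ℝ, L 2 (e 1) + L 2 (0, v) = 2 * L 0 (e 2) := by
    intro v
    have := key ![0, v, 0] (fun i j => if i = 0 ∧ j = 2 then 1 else 0) (by simp)
    simp [hA, hA1] at this
    linarith
  have hC1 : L 2 (e 1) = 2 * L 0 (e 2) := by simpa [h0] using hty 0
  have hC : ∀ v : Fin 2 → ℝ, L 2 (0, v) = 0 := fun v => by simpa [hC1] using hty v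
  have htx : ∀ v : Fin 2 → ℝ, L 0 (e 0) + (L 1 (e 1) + L 1 (0, v)) + w 0 * L 0 (e 2)
      = 2 * L 2 (e 2) - w 0 * L 2 (e 1) := by
    intro v
    have := key ![0, v, 0]
      (fun i j => if (i = 0 ∧ j = 1) ∨ (i = 2 ∧ j = 2) then 1 else 0) (by simp)
    simp [hA, hA1, hC] at this
    linarith
  have hB1 : L 0 (e 0) + L 1 (e 1) + w 0 * L 0 (e 2) = 2 * L 2 (e 2) - w 0 * L 2 (e 1) := by
    simpa [h0] using htx 0
  have hB : ∀ v : Fin 2 → ℝ, L 1 (0, v) = 0 := fun v => by linarith [htx v]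
  -- The entry of `d` at `(2, 2)` is the value forced by `hd`. The coefficients of `u_xy` and `u_xx`
  -- then give the two fibre components of `X`.
  have hxy := key 0 (fun i j => if i = 1 ∧ j = 2 then 1 else if i = 2 ∧ j = 2 then w 0 else 0)
    (by simp)
  have hxx := key 0 (fun i j => if i = 1 ∧ j = 1 then 1 else if i = 2 ∧ j = 2 then w 1 else 0)
    (by simp)
  simp [hA, hA1, hB, hC] at hxy hxx
  refine ⟨fun l => ?_, hA1, hC1, hB1, by linarith, by linarith⟩
  fin_cases l
  exacts [hA, hB, hC]

theorem ext_ev {f g : Sm} (H : ∀ x, ev x f = ev x g) : f = g := Subtype.ext (funext H)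

theorem res_compF_field (h : Fin 3 → Sm) (s : Fin 2 → Sm) (α : Fin 2) :
    res (compF (contDiff_field h) α) s = fibS h s α :=
  Subtype.ext (funext fun z => field_snd h s z α)

/-- The part of the determining equations for `field h` of order at most one in the jet
variables. -/
theorem mem_symAlg_of_isSymmetry {h : Fin 3 → Sm} (hsym : IsSymmetry (field h))
    (h1 : D 1 (h 0) = 0) (h2 : D 2 (h 0) = 0) (h3 : D 1 (h 2) = 0)
    (h4 : D 1 (h 1) = D 2 (h 2) + D 2 (h 2) - D 0 (h 0)) : h ∈ symAlg := by
  have h7 : D 1 (D 2 (h 2)) = 0 := by rw [D_comm, h3, map_zero]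
  have h8 : D 1 (D 2 (h 1)) = D 2 (D 2 (h 2)) + D 2 (D 2 (h 2)) := by
    rw [D_comm, h4, map_sub, map_add, D_two_zero, h2]; simp
  have h9 : D 1 (D 2 (D 2 (h 1))) = D 2 (D 2 (D 2 (h 2))) + D 2 (D 2 (D 2 (h 2))) := by
    rw [D_comm, h8, map_add]
  -- At `w = 0`, with zero second derivatives and zero first derivatives of `v`, the condition `u_x
  -- u_y = 0` is what places the jet on the equation.
  have key : ∀ (x : Base) (m : Fin 3 → Fin 2 → ℝ), m 1 0 * m 2 0 = 0 →
      (∀ i, m i 1 = 0) →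
      ev x (D 2 (D 2 (D 2 (h 1)))) * 2 - ev x (D 0 (D 2 (D 2 (h 2)))) * 5
        - 5 * m 2 0 * ev x (D 2 (D 2 (h 2)))
        + m 1 0 * (2 * ev x (D 0 (D 2 (h 2))) - ev x (D 0 (D 0 (h 0)))
          - ev x (D 2 (D 2 (h 1)))) = 0 := by
    intro x m hm hm1
    have e := hsym.2 (twoJet x 0 m 0) ((F_twoJet x 0 m 0).2 (by simp [hm, hm1])) 0
    rw [fderiv_F₁_prolong hsym.1 _ rfl (fun _ => rfl) (res_compF_field h _)] at e
    have hY : ∀ l, res (compB hsym.1 l) (tay (twoJet x 0 m 0)) = h l := fun _ => rfl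
    simp only [hY] at e
    have hc : ∀ α, ev x (tay (twoJet x 0 m 0) α) = 0 := coe_tay_twoJet x 0 m 0
    have hD : ∀ α i, ev x (D i (tay (twoJet x 0 m 0) α)) = m i α := coe_D_tay_twoJet x 0 m 0
    have hDD : ∀ α (i j : Fin 3), i ≤ j → ev x (D i (D j (tay (twoJet x 0 m 0) α))) = 0 :=
      coe_D_D_tay_twoJet x 0 m 0
    simp only [fibS, Matrix.cons_val_zero, Matrix.cons_val_one, map_add, map_sub, map_zero,
      Derivation.leibniz, smul_eq_mul, D_one_zero, D_two_zero, h1, h2, h3, h4, h7, h8,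
      h9, mul_zero, add_zero, zero_add, sub_zero, map_mul, map_ofNat, twoJet_fst, hc, hD, hm1, zero_mul,
      hDD _ _ _ (le_refl _), hDD _ 0 1 (by decide), hDD _ 1 2 (by decide)] at e
    linear_combination e + (ev x (D 2 (h 2)) + ev x (D 0 (h 0))) * hm
  refine ⟨h1, h2, h3, h4, ext_ev fun x => ?_, ext_ev fun x => ?_⟩
  -- Comparing the zero jet with `u_y = 1` isolates `∂_y² h 2`; in the next case `u_x = 1` isolates
  -- the equation for `∂_y² h 1`.
  · have e0 := key x 0 (by simp) (by simp)
    have e1 := key x ![0, 0, ![1, 0]] (by simp) (by simp [Fin.forall_fin_succ])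
    simp at e0 e1
    rw [map_zero]
    linarith
  · have e0 := key x 0 (by simp) (by simp)
    have e1 := key x ![0, ![1, 0], 0] (by simp) (by simp [Fin.forall_fin_succ])
    simp at e0 e1
    simp only [map_sub, map_add]
    linarith

/-- Classification of the symmetries. -/
theorem exists_eq_field {X : Total → Total} (hX : IsSymmetry X) :
    ∃ h ∈ symAlg, X = field h := by
  -- The base components will turn out to be independent of the fibre, so their values on the zero
  -- section serve as `h`.
  let h : Fin 3 → Sm := fun l =>
    ⟨fun z => (X (z, 0)).1 l, ((compB hX.1 l).2.comp (contDiff_id.prodMk contDiff_const) :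
      ContDiff ℝ ∞ ((compB hX.1 l).1 ∘ fun z : Base => (z, (0 : Fin 2 → ℝ))))⟩
  have hdiff : ∀ l, Differentiable ℝ (compB hX.1 l).1 :=
    fun l => (compB hX.1 l).2.differentiable (by simp)
  have hconst : ∀ l (p : Total), (X p).1 l = ev p.1 (h l) := by
    rintro l ⟨x, w⟩
    have hd : Differentiable ℝ fun w : Fin 2 → ℝ => (compB hX.1 l).1 (x, w) :=
      (hdiff l).comp ((differentiable_const x).prodMk differentiable_id)
    refine is_const_of_fderiv_eq_zero hd (fun w => ContinuousLinearMap.ext fun v => ?_) w 0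
    have h1 : HasFDerivAt (fun w : Fin 2 → ℝ => (x, w))
        ((0 : (Fin 2 → ℝ) →L[ℝ] Base).prod (ContinuousLinearMap.id ℝ (Fin 2 → ℝ))) w :=
      (hasFDerivAt_const x w).prodMk (hasFDerivAt_id w)
    have h2 := (((hdiff l) (x, w)).hasFDerivAt.comp w h1).fderiv
    change fderiv ℝ ((compB hX.1 l).1 ∘ fun w : Fin 2 → ℝ => (x, w)) w v = 0
    rw [h2]
    exact (first_order_determining hX x w rfl rfl).1 l v
  have hD : ∀ l i (x : Base) (w : Fin 2 → ℝ),
      fderiv ℝ (compB hX.1 l).1 (x, w) (Pi.single i 1, 0) = ev x (D i (h l)) := by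
    intro l i x w
    have h0 : (compB hX.1 l).1 = (h l : Base → ℝ) ∘ Prod.fst := funext fun p => hconst l p
    have h1 : HasFDerivAt (Prod.fst : Total → Base)
        (ContinuousLinearMap.fst ℝ Base (Fin 2 → ℝ)) (x, w) := hasFDerivAt_fst
    have h2 := (HasFDerivAt.comp (x, w)
      (differentiableAt_coe (h l) x).hasFDerivAt h1).fderiv
    rw [h0, h2]
    rfl
  have key := fun (x : Base) (w : Fin 2 → ℝ) => (first_order_determining hX x w rfl rfl).2
  simp only [hD] at key
  -- The third relation at `w 0 = 0` and `w 0 = 1` gives `∂_y h 0 + ∂_x h 2 = 0`; with `∂_x h 2 = 2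
  -- ∂_y h 0` both vanish.
  have hA2 : ∀ x, ev x (D 2 (h 0)) = 0 := by
    intro x
    have k0 := (key x 0).2
    have k1 := (key x ![1, 0]).2
    simp at k0 k1
    linarith [k0.1, k0.2.1, k1.2.1]
  have h2 : D 2 (h 0) = 0 := Subtype.ext (funext hA2)
  have h1 : D 1 (h 0) = 0 := Subtype.ext (funext fun x => (key x 0).1)
  have h3 : D 1 (h 2) = 0 := Subtype.ext (funext fun x => by
    have := (key x 0).2.1
    rw [hA2, mul_zero] at this
    exact this)
  have h4 : D 1 (h 1) = D 2 (h 2) + D 2 (h 2) - D 0 (h 0) := ext_ev fun x => by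
    have := (key x 0).2.2.1
    simp only [h2, h3, map_zero] at this
    rw [map_sub, map_add]
    linarith
  have hf : X = field h := by
    funext p
    obtain ⟨x, w⟩ := p
    obtain ⟨-, -, -, hu, hv⟩ := key x w
    simp only [h3, h4, map_zero, map_sub, map_add] at hu hv
    refine Prod.ext (funext fun l => hconst l _) (funext fun α => ?_)
    fin_cases α
    · refine hu.trans ?_
      simp [field]
      ring
    · refine hv.trans ?_
      simp [field]
      ring
  exact ⟨h, mem_symAlg_of_isSymmetry (hf ▸ hX) h1 h2 h3 h4, hf⟩

/-! ### Order of vanishing and isotropy. -/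

/-- The function `f` vanishes at `x` to order `n`. -/
def Van (x : Base) (n : ℕ) (f : Sm) : Prop :=
  ∀ σ : Fin 3 → ℕ, ∑ j, σ j < n → ev x (Dm σ f) = 0

namespace Van

variable {x : Base} {n m : ℕ} {f g : Sm}

theorem mono (hf : Van x n f) (h : m ≤ n) : Van x m f := fun σ hσ => hf σ (hσ.trans_le h)

theorem add (hf : Van x n f) (hg : Van x n g) : Van x n (f + g) := fun σ hσ => by
  rw [map_add, map_add, hf σ hσ, hg σ hσ, add_zero]

theorem sub (hf : Van x n f) (hg : Van x n g) : Van x n (f - g) := fun σ hσ => by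
  rw [map_sub, map_sub, hf σ hσ, hg σ hσ, sub_zero]

theorem zero : Van x n 0 := fun σ _ => by rw [map_zero, map_zero]

theorem deriv (hf : Van x (n + 1) f) (i : Fin 3) : Van x n (D i f) := fun σ hσ => by
  rw [Dm_D]
  exact hf _ (by rw [sum_add_single]; omega)

theorem mul_right (hf : Van x n f) (g : Sm) : Van x n (f * g) := by
  intro σ hσ
  induction n generalizing f g σ with
  | zero => simp at hσ
  | succ n ih =>
    by_cases h0 : σ = 0
    · subst h0
      have := hf 0 hσ
      rw [Dm_zero] at this ⊢
      rw [map_mul, this, zero_mul]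
    · obtain ⟨τ, i, rfl⟩ := exists_eq_add_single h0
      rw [sum_add_single] at hσ
      rw [← Dm_D, Derivation.leibniz, map_add, map_add, smul_eq_mul, smul_eq_mul, mul_comm g,
        ih (hf.mono (Nat.le_succ n)) _ τ (by omega), ih (hf.deriv i) _ τ (by omega), add_zero]

theorem mul_left (hf : Van x n f) (g : Sm) : Van x n (g * f) := by
  rw [mul_comm]; exact hf.mul_right g

/-- The leading derivatives of a product with a vanishing factor. -/
theorem ev_Dm_mul (hf : Van x n f) (g : Sm) (σ : Fin 3 → ℕ) (hσ : ∑ j, σ j = n) :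
    ev x (Dm σ (g * f)) = ev x g * ev x (Dm σ f) := by
  induction n generalizing f σ with
  | zero =>
    have : σ = 0 := funext fun j => by simpa using (Finset.sum_eq_zero_iff.1 hσ) j (by simp)
    subst this
    simp
  | succ n ih =>
    have h0 : σ ≠ 0 := by rintro rfl; simp at hσ
    obtain ⟨τ, i, rfl⟩ := exists_eq_add_single h0
    rw [sum_add_single] at hσ
    rw [← Dm_D, ← Dm_D, Derivation.leibniz, map_add, map_add, smul_eq_mul, smul_eq_mul,
      ih (hf.deriv i) τ (by omega), hf.mul_right (D i g) τ (by omega), add_zero]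

/-- A derivative containing an `x` or a `y` is covered by `h1` or `h2`, so only pure `t`-derivatives
need checking. -/
theorem of_deriv (ht : ∀ j < n + 1, ev x (Dm ![j, 0, 0] f) = 0) (h1 : Van x n (D 1 f))
    (h2 : Van x n (D 2 f)) : Van x (n + 1) f := by
  intro σ hσ
  have hred : ∀ i : Fin 3, Van x n (D i f) → σ i ≠ 0 → ev x (Dm σ f) = 0 := by
    intro i hi h0
    have : σ = (σ - Pi.single i 1) + Pi.single i 1 :=
      (tsub_add_cancel_of_le fun j => by
        by_cases hj : j = i
        · subst hj; simp only [Pi.single_eq_same]; omega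
        · simp [hj]).symm
    rw [this, sum_add_single] at hσ
    rw [this, ← Dm_D]
    exact hi _ (by omega)
  by_cases hx : σ 1 = 0
  · by_cases hy : σ 2 = 0
    · have : σ = ![σ 0, 0, 0] := by
        funext j
        fin_cases j
        exacts [rfl, hx, hy]
      rw [this]
      refine ht _ ?_
      rw [Fin.sum_univ_three] at hσ
      omega
    · exact hred 2 h2 hy
  · exact hred 1 h1 hx

end Van

theorem Dm_t_succ (j : ℕ) (f : Sm) : Dm ![j + 1, 0, 0] f = Dm ![j, 0, 0] (D 0 f) := by
  simp [Dm_vec]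

theorem Dm_tx (j : ℕ) (f : Sm) : Dm ![j, 1, 0] f = Dm ![j, 0, 0] (D 1 f) := by
  simp [Dm_vec]

theorem Dm_ty (j : ℕ) (f : Sm) : Dm ![j, 0, 1] f = Dm ![j, 0, 0] (D 2 f) := by
  simp [Dm_vec]

section
variable {h : Fin 3 → Sm}

theorem D_one_D_two_h2 (hh : h ∈ symAlg) : D 1 (D 2 (h 2)) = 0 := by
  rw [D_comm, hh.2.2.1, map_zero]

theorem D_one_D_two_h1 (hh : h ∈ symAlg) : D 1 (D 2 (h 1)) = 0 := by
  rw [D_comm, hh.2.2.2.1, map_sub, map_add, hh.2.2.2.2.1, D_two_zero, hh.2.1]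
  simp

/-- A symmetry is determined by its pure `t`-derivatives. -/
theorem van_of_t_derivs (hh : h ∈ symAlg) {x : Base} {n : ℕ}
    (hA : ∀ j < n + 2, ev x (Dm ![j, 0, 0] (h 0)) = 0)
    (hC : ∀ j < n + 2, ev x (Dm ![j, 0, 0] (h 2)) = 0)
    (hB : ∀ j < n + 2, ev x (Dm ![j, 0, 0] (h 1)) = 0)
    (hCy : ∀ j < n + 1, ev x (Dm ![j, 0, 0] (D 2 (h 2))) = 0)
    (hBy : ∀ j < n + 1, ev x (Dm ![j, 0, 0] (D 2 (h 1))) = 0) (l : Fin 3) :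
    Van x (n + 2) (h l) := by
  have hxC := D_one_D_two_h2 hh
  have hxB := D_one_D_two_h1 hh
  obtain ⟨h1, h2, h3, h4, h5, h6⟩ := hh
  have vA : Van x (n + 2) (h 0) := Van.of_deriv hA (h1 ▸ Van.zero) (h2 ▸ Van.zero)
  have vCy : Van x (n + 1) (D 2 (h 2)) := Van.of_deriv hCy (hxC ▸ Van.zero) (h5 ▸ Van.zero)
  have vC : Van x (n + 2) (h 2) := Van.of_deriv hC (h3 ▸ Van.zero) vCy
  have vBy : Van x (n + 1) (D 2 (h 1)) := by
    refine Van.of_deriv hBy (hxB ▸ Van.zero) ?_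
    rw [h6]
    exact ((vCy.deriv 0).add (vCy.deriv 0)).sub ((vA.deriv 0).deriv 0)
  have vB : Van x (n + 2) (h 1) := by
    refine Van.of_deriv hB ?_ vBy
    rw [h4]
    exact (vCy.add vCy).sub (vA.deriv 0)
  fin_cases l
  exacts [vA, vB, vC]

/-- One order is lost because the fibre components contain first derivatives of `h`. -/
theorem van_genS {x : Base} {n : ℕ} (hv : ∀ l, Van x (n + 1) (h l)) (s : Fin 2 → Sm)
    (α : Fin 2) : Van x n (genS h s α) := by
  have hv' : ∀ l, Van x n (h l) := fun l => (hv l).mono (Nat.le_succ n)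
  refine Van.sub ?_ ((((hv' 0).mul_right _).add ((hv' 1).mul_right _)).add ((hv' 2).mul_right _))
  have vm : Van x n (D 2 (h 2) - D 0 (h 0)) := ((hv 2).deriv 2).sub ((hv 0).deriv 0)
  fin_cases α
  · exact (((hv 2).deriv 0).add (vm.mul_left _)).sub (((hv 1).deriv 2).add ((hv 1).deriv 2))
  · exact (((hv 1).deriv 0).add (vm.mul_left _)).add (((hv 1).deriv 2).mul_left _)

/-- One step of the reconstruction of a symmetry from its prolongation. -/
theorem van_succ (hh : h ∈ symAlg) {x : Base} {s : Fin 2 → Sm} {p : ℕ}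
    (hv : ∀ l, Van x (p + 2) (h l))
    (hg : ∀ (α : Fin 2) (σ : Fin 3 → ℕ), ∑ j, σ j = p + 1 → ev x (Dm σ (genS h s α)) = 0)
    (l : Fin 3) : Van x (p + 3) (h l) := by
  have hxC := D_one_D_two_h2 hh
  have hxB := D_one_D_two_h1 hh
  have hh' := hh
  obtain ⟨h1, h2, h3, h4, h5, h6⟩ := hh'
  have vm : Van x (p + 1) (D 2 (h 2) - D 0 (h 0)) := ((hv 2).deriv 2).sub ((hv 0).deriv 0)
  have vb : Van x (p + 1) (D 2 (h 1)) := (hv 1).deriv 2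
  have hz : ∀ (α : Fin 2) (σ : Fin 3 → ℕ), ∑ j, σ j = p + 1 →
      ev x (Dm σ (h 0 * D 0 (s α) + h 1 * D 1 (s α) + h 2 * D 2 (s α))) = 0 :=
    fun α σ hσ => ((((hv 0).mul_right _).add ((hv 1).mul_right _)).add ((hv 2).mul_right _)) σ
      (by omega)
  -- At order `p + 1` the transport terms vanish and the factors `u, v` are frozen at `x`, leaving a
  -- linear system for the derivatives of `h` of order `p + 2`.
  have hu : ∀ σ : Fin 3 → ℕ, ∑ j, σ j = p + 1 → ev x (Dm σ (D 0 (h 2)))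
      + ev x (s 0) * ev x (Dm σ (D 2 (h 2) - D 0 (h 0))) - 2 * ev x (Dm σ (D 2 (h 1))) = 0 := by
    intro σ hσ
    have e := hg 0 σ hσ
    rw [genS, map_sub, map_sub, hz 0 σ hσ] at e
    simp only [fibS, Matrix.cons_val_zero, map_add, map_sub (ev x), map_sub (Dm σ) _ (_ + _)] at e
    rw [vm.ev_Dm_mul _ σ hσ] at e
    linarith
  have hw : ∀ σ : Fin 3 → ℕ, ∑ j, σ j = p + 1 → ev x (Dm σ (D 0 (h 1)))
      + 2 * ev x (s 1) * ev x (Dm σ (D 2 (h 2) - D 0 (h 0)))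
      + ev x (s 0) * ev x (Dm σ (D 2 (h 1))) = 0 := by
    intro σ hσ
    have e := hg 1 σ hσ
    rw [genS, map_sub, map_sub, hz 1 σ hσ] at e
    simp only [fibS, Matrix.cons_val_one, Matrix.cons_val_zero, map_add] at e
    rw [vm.ev_Dm_mul _ σ hσ, vb.ev_Dm_mul _ σ hσ, map_add] at e
    linarith
  have st : ∑ j, ![p + 1, 0, 0] j = p + 1 := by simp [Fin.sum_univ_three]
  have sx : ∑ j, ![p, 1, 0] j = p + 1 := by simp [Fin.sum_univ_three]
  have sy : ∑ j, ![p, 0, 1] j = p + 1 := by simp [Fin.sum_univ_three]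
  have ut := hu _ st
  have uy := hu _ sy
  have wt := hw _ st
  have wx := hw _ sx
  have wy := hw _ sy
  simp only [Dm_t_succ, Dm_tx, Dm_ty, map_add, map_sub, D_one_zero, D_two_zero, h1, h2, h4, h5,
    h6, hxC, hxB, map_zero, sub_zero, mul_zero, add_zero] at ut uy wt wx wy
  -- After `p` derivatives in `t`, `wx` reads `2 c' - a'' = 0` and `uy` reads `2 a'' - 3 c' = 0`,
  -- which are independent. Then `wy`, `ut`, `wt` successively kill `∂_t ∂_y h 1`, `∂_t² h 2`, `∂_t²
  -- h 1`.
  have ea : ev x (Dm ![p, 0, 0] (D 0 (D 0 (h 0)))) = 0 := by linarith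
  have ec : ev x (Dm ![p, 0, 0] (D 0 (D 2 (h 2)))) = 0 := by linarith
  rw [ea, ec] at ut wt wy
  simp only [add_zero, sub_zero, mul_zero] at ut wt wy
  rw [wy] at ut wt
  simp only [add_zero, sub_zero, mul_zero] at ut wt
  have step : ∀ (f : Sm) (n : ℕ), (∀ j < n, ev x (Dm ![j, 0, 0] f) = 0) →
      ev x (Dm ![n, 0, 0] f) = 0 → ∀ j < n + 1, ev x (Dm ![j, 0, 0] f) = 0 := by
    intro f n hlt hn j hj
    rcases Nat.lt_succ_iff_lt_or_eq.1 hj with hj | rfl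
    exacts [hlt j hj, hn]
  have hvt : ∀ (f : Sm) (n : ℕ), Van x n f → ∀ j < n, ev x (Dm ![j, 0, 0] f) = 0 :=
    fun f n hf j hj => hf _ (by simpa [Fin.sum_univ_three] using hj)
  refine van_of_t_derivs hh (n := p + 1) (step _ _ (hvt _ _ (hv 0)) ?_)
    (step _ _ (hvt _ _ (hv 2)) ?_) (step _ _ (hvt _ _ (hv 1)) ?_)
    (step _ _ (hvt _ _ ((hv 2).deriv 2)) ?_) (step _ _ (hvt _ _ ((hv 1).deriv 2)) ?_) l
  · rwa [Dm_t_succ, Dm_t_succ]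
  · rwa [Dm_t_succ, Dm_t_succ]
  · rwa [Dm_t_succ, Dm_t_succ]
  · rwa [Dm_t_succ]
  · rwa [Dm_t_succ]

/-- The hypotheses `hA`, `hC`, `hB` supply the first derivatives that the order-zero equations miss:
those equations yield only `∂_t h 2` and `∂_t h 1`. From there `van_succ` gains one order at a time.
-/
theorem van_of_genS_eq_zero (hh : h ∈ symAlg) {x : Base} {s : Fin 2 → Sm} {k : ℕ}
    (h0 : ∀ l, ev x (h l) = 0) (hA : ev x (D 0 (h 0)) = 0) (hC : ev x (D 2 (h 2)) = 0)
    (hB : ev x (D 2 (h 1)) = 0)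
    (hg : ∀ (α : Fin 2) (σ : Fin 3 → ℕ), ∑ j, σ j ≤ k → ev x (Dm σ (genS h s α)) = 0) :
    ∀ l, Van x (k + 2) (h l) := by
  suffices H : ∀ m ≤ k, ∀ l, Van x (m + 2) (h l) from H k le_rfl
  intro m hm
  induction m with
  | zero =>
    have g0 := hg 0 0 (by simp)
    have g1 := hg 1 0 (by simp)
    simp [genS, fibS, h0, hA, hB, hC] at g0 g1
    have two : ∀ f : Sm, ev x f = 0 → ev x (D 0 f) = 0 →
        ∀ j < 2, ev x (Dm ![j, 0, 0] f) = 0 := by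
      intro f hf0 hf1 j hj
      interval_cases j
      · simpa [Dm_vec] using hf0
      · simpa [Dm_vec] using hf1
    have one : ∀ f : Sm, ev x f = 0 → ∀ j < 1, ev x (Dm ![j, 0, 0] f) = 0 := by
      intro f hf0 j hj
      interval_cases j
      simpa [Dm_vec] using hf0
    exact van_of_t_derivs hh (two _ (h0 0) hA) (two _ (h0 2) g0) (two _ (h0 1) g1) (one _ hC)
      (one _ hB)
  | succ p ih =>
    exact van_succ hh (ih (by omega)) fun α σ hσ => hg α σ (by omega)

/-- The terms in `∂_t h 0` cancel between the fibre component and `∂_x h 1 · u_x`, and `∂_y h 1`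
does not depend on `x`. First order therefore constrains `∂_y h 2` alone, and differentiating once
more brings in `∂_t h 0` and `∂_y h 1` with factor `u_xx`. -/
theorem D_one_genS (hh : h ∈ symAlg) (s : Fin 2 → Sm) : D 1 (genS h s 0) =
    - (D 2 (h 2) * D 1 (s 0))
      - (h 0 * D 0 (D 1 (s 0)) + h 1 * D 1 (D 1 (s 0)) + h 2 * D 1 (D 2 (s 0))) := by
  have hxC := D_one_D_two_h2 hh
  have hxB := D_one_D_two_h1 hh
  obtain ⟨h1, h2, h3, h4, h5, h6⟩ := hh
  simp only [genS, fibS, Matrix.cons_val_zero, map_add, map_sub, map_zero,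
    Derivation.leibniz, smul_eq_mul, D_one_zero, h1, h3, h4, hxC, hxB]
  ring

/-- At points with `u_x ≠ 0` the isotropy satisfies `∂_y X^y = 0`. -/
theorem ev_D_two_h2_eq_zero (hh : h ∈ symAlg) {x : Base} {s : Fin 2 → Sm}
    (h0 : ∀ l, ev x (h l) = 0) (hx : ev x (D 1 (s 0)) ≠ 0)
    (hg : ev x (D 1 (genS h s 0)) = 0) : ev x (D 2 (h 2)) = 0 := by
  rw [D_one_genS hh] at hg
  simpa [h0, hx] using hg

/-- At points with `u_xx ≠ 0`, second order isotropy. -/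
theorem ev_D_eq_zero (hh : h ∈ symAlg) {x : Base} {s : Fin 2 → Sm}
    (h0 : ∀ l, ev x (h l) = 0) (hC : ev x (D 2 (h 2)) = 0) (hxx : ev x (D 1 (D 1 (s 0))) ≠ 0)
    (hg1 : ev x (D 1 (D 1 (genS h s 0))) = 0) (hg2 : ev x (D 1 (D 2 (genS h s 0))) = 0) :
    ev x (D 0 (h 0)) = 0 ∧ ev x (D 2 (h 1)) = 0 := by
  have hxC := D_one_D_two_h2 hh
  rw [D_one_genS hh] at hg1
  rw [D_comm, D_one_genS hh] at hg2
  obtain ⟨h1, h2, h3, h4, h5, h6⟩ := hh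
  simp only [map_add, map_sub, map_neg, Derivation.leibniz, smul_eq_mul, map_mul, h0, h1, h2, h3,
    h4, h5, hxC, hC, map_zero] at hg1 hg2
  constructor
  · refine (mul_eq_zero.1 ?_).resolve_right hxx
    linear_combination hg1
  · refine (mul_eq_zero.1 ?_).resolve_right hxx
    linear_combination -hg2

end

/-! ### Finite-dimensional parametrization and rank count. -/

/-- The prolongation at `θ`, as a linear map on the symmetry algebra. -/
def prolongL (k : ℕ) (θ : Jet k) : symAlg →ₗ[ℝ] Jet k where
  toFun h := prolong k (field h.1) θ
  map_add' f g := by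
    refine Prod.ext (funext fun i => ?_) (funext fun q => ?_)
    · change ev θ.1 (f.1 i + g.1 i) = ev θ.1 (f.1 i) + ev θ.1 (g.1 i)
      rw [map_add]
    · rw [Prod.snd_add, Pi.add_apply, prolong_field_snd, prolong_field_snd, prolong_field_snd,
        ← map_add]
      congr 1
      obtain ⟨α, σ⟩ := q
      have : genS (f.1 + g.1) (tay θ) α = genS f.1 (tay θ) α + genS g.1 (tay θ) α := by
        fin_cases α <;> simp [genS, fibS] <;> ring
      change proS (f.1 + g.1) (tay θ) α σ.1 = proS f.1 (tay θ) α σ.1 + proS g.1 (tay θ) α σ.1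
      simp only [proS, this, map_add, Pi.add_apply]
      ring
  map_smul' c f := by
    refine Prod.ext (funext fun i => ?_) (funext fun q => ?_)
    · change ev θ.1 (c • f.1 i) = c • ev θ.1 (f.1 i)
      rw [map_smul]
    · rw [Prod.smul_snd, Pi.smul_apply, prolong_field_snd, prolong_field_snd, RingHom.id_apply,
        ← map_smul]
      congr 1
      obtain ⟨α, σ⟩ := q
      have : genS (c • f.1) (tay θ) α = c • genS f.1 (tay θ) α := by
        fin_cases α <;> simp [genS, fibS, Algebra.smul_def] <;> ring
      change proS (c • f.1) (tay θ) α σ.1 = c • proS f.1 (tay θ) α σ.1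
      simp only [proS, this, map_smul, Pi.smul_apply, smul_add, smul_mul_assoc]

/-- The symmetries already form a linear space, so the span adds nothing. -/
theorem orbitTangent_eq (k : ℕ) (θ : Jet k) : orbitTangent k θ = LinearMap.range (prolongL k θ) := by
  have : {w | ∃ X : Total → Total, IsSymmetry X ∧ w = prolong k X θ}
      = (LinearMap.range (prolongL k θ) : Set (Jet k)) := by
    ext w
    constructor
    · rintro ⟨X, hX, rfl⟩
      obtain ⟨h, hh, rfl⟩ := exists_eq_field hX
      exact ⟨⟨h, hh⟩, rfl⟩
    · rintro ⟨h, rfl⟩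
      exact ⟨field h.1, isSymmetry_field h.2, rfl⟩
  rw [orbitTangent, this, Submodule.span_eq]

/-- The space of parameters of the `k`-th prolongation of a symmetry at a point. -/
abbrev Params (k : ℕ) : Type :=
  (Fin (k + 2) → ℝ) × (Fin (k + 1) → ℝ) × (Fin (k + 2) → ℝ) × (Fin (k + 1) → ℝ) ×
    (Fin (k + 2) → ℝ)

theorem finrank_Params (k : ℕ) : Module.finrank ℝ (Params k) = 5 * k + 8 := by
  simp only [Params, Module.finrank_prod, Module.finrank_fin_fun]
  ring

/-- The first `n` pure `t`-derivatives at `x`. -/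
def tDerivs (x : Base) (n : ℕ) : Sm →ₗ[ℝ] (Fin n → ℝ) :=
  LinearMap.pi fun j => (ev x).toLinearMap ∘ₗ Dm ![(j : ℕ), 0, 0]

theorem tDerivs_apply (x : Base) (n : ℕ) (f : Sm) (j : Fin n) :
    tDerivs x n f j = ev x (Dm ![(j : ℕ), 0, 0] f) := rfl

/-- The parameters of a symmetry at a point. -/
def params (x : Base) (k : ℕ) : (Fin 3 → Sm) →ₗ[ℝ] Params k :=
  (tDerivs x _ ∘ₗ LinearMap.proj 0).prod
    ((tDerivs x _ ∘ₗ (D 2 : Module.End ℝ Sm) ∘ₗ LinearMap.proj 2).prod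
      ((tDerivs x _ ∘ₗ LinearMap.proj 2).prod
        ((tDerivs x _ ∘ₗ (D 2 : Module.End ℝ Sm) ∘ₗ LinearMap.proj 1).prod
          (tDerivs x _ ∘ₗ LinearMap.proj 1))))

/-- The polynomial in `t` with given derivatives at `x`. -/
def tPoly (x : Base) (n : ℕ) : (Fin n → ℝ) →ₗ[ℝ] Sm :=
  Fintype.linearCombination ℝ fun j : Fin n => dpow x 0 j

theorem D_tPoly (x : Base) (n : ℕ) (a : Fin n → ℝ) {i : Fin 3} (hi : i ≠ 0) :
    D i (tPoly x n a) = 0 := by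
  simp [tPoly, Fintype.linearCombination_apply, D_dpow_of_ne x hi]

theorem tDerivs_tPoly (x : Base) (n : ℕ) (a : Fin n → ℝ) : tDerivs x n (tPoly x n a) = a := by
  funext j
  have hm : ∀ i : ℕ, dpow x 0 i = monom x ![i, 0, 0] := by
    intro i
    simp [monom, Fin.prod_univ_three]
  have hv : ∀ i j : ℕ, (![i, 0, 0] = (![j, 0, 0] : Fin 3 → ℕ)) ↔ i = j := by
    intro i j
    constructor
    · intro h; exact congrFun h 0
    · rintro rfl; rfl
  simp [tDerivs_apply, tPoly, Fintype.linearCombination_apply, hm, ev_Dm_monom, hv, Fin.val_inj]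

theorem Dm_t_mul {g : Sm} (hg : D 0 g = 0) (j : ℕ) (f : Sm) :
    Dm ![j, 0, 0] (f * g) = Dm ![j, 0, 0] f * g := by
  induction j generalizing f with
  | zero => simp [Dm_vec]
  | succ j ih =>
    rw [Dm_t_succ, Dm_t_succ, Derivation.leibniz, hg, smul_zero, zero_add, smul_eq_mul, mul_comm,
      ih]

theorem tDerivs_mul_eq_zero {x : Base} {g : Sm} (hg : D 0 g = 0) (hx : ev x g = 0) (n : ℕ)
    (f : Sm) : tDerivs x n (f * g) = 0 := by
  funext j
  rw [tDerivs_apply, Dm_t_mul hg, map_mul, hx, mul_zero]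
  rfl

/-- The symmetry with polynomial coefficients and given parameters. -/
def ofParams (x : Base) (k : ℕ) (p : Params k) : Fin 3 → Sm :=
  let a := tPoly x _ p.1
  let c := tPoly x _ p.2.1
  let d := tPoly x _ p.2.2.1
  let e := tPoly x _ p.2.2.2.1
  let f := tPoly x _ p.2.2.2.2
  ![a, (c + c - D 0 a) * cen x 1 + (D 0 c + D 0 c - D 0 (D 0 a)) * dpow x 2 2 + e * cen x 2 + f,
    c * cen x 2 + d]

theorem D_two_ofParams_one (x : Base) (k : ℕ) (p : Params k) : D 2 (ofParams x k p 1) =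
    (D 0 (tPoly x _ p.2.1) + D 0 (tPoly x _ p.2.1) - D 0 (D 0 (tPoly x _ p.1))) * cen x 2
      + tPoly x _ p.2.2.2.1 := by
  have h2 : ∀ n a, D 2 (tPoly x n a) = 0 := fun n a => D_tPoly x n a (by decide)
  have hd : D 2 (dpow x 2 2) = cen x 2 := by
    rw [D_dpow_succ]; simp [dpow]
  simp [ofParams, Derivation.leibniz, D_two_zero, h2, hd]

theorem D_two_ofParams_two (x : Base) (k : ℕ) (p : Params k) :
    D 2 (ofParams x k p 2) = tPoly x _ p.2.1 := by
  have h2 : ∀ n a, D 2 (tPoly x n a) = 0 := fun n a => D_tPoly x n a (by decide)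
  simp [ofParams, Derivation.leibniz, h2]

theorem ofParams_mem (x : Base) (k : ℕ) (p : Params k) : ofParams x k p ∈ symAlg := by
  have h1 : ∀ n a, D 1 (tPoly x n a) = 0 := fun n a => D_tPoly x n a (by decide)
  have h2 : ∀ n a, D 2 (tPoly x n a) = 0 := fun n a => D_tPoly x n a (by decide)
  refine ⟨h1 _ _, h2 _ _, ?_, ?_, ?_, ?_⟩
  · simp [ofParams, Derivation.leibniz, h1]
  · rw [D_two_ofParams_two]
    simp [ofParams, Derivation.leibniz, D_one_zero, h1, D_dpow_of_ne]
  · rw [D_two_ofParams_two, h2]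
  · rw [D_two_ofParams_one, D_two_ofParams_two]
    simp [ofParams, Derivation.leibniz, D_two_zero, h2]

/-- `ofParams` as a linear map into the symmetry algebra. -/
def ofParamsL (x : Base) (k : ℕ) : Params k →ₗ[ℝ] symAlg where
  toFun p := ⟨ofParams x k p, ofParams_mem x k p⟩
  map_add' p q := by
    refine Subtype.ext (funext fun i => ?_)
    change ofParams x k (p + q) i = ofParams x k p i + ofParams x k q i
    fin_cases i <;> simp [ofParams] <;> ring
  map_smul' c p := by
    refine Subtype.ext (funext fun i => ?_)
    change ofParams x k (c • p) i = c • ofParams x k p i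
    fin_cases i <;> simp [ofParams, smul_add, smul_sub, add_mul, sub_mul]

/-- Every unwanted term is a function times a factor that is constant in `t` and vanishes at `x`,
hence has no pure `t`-derivatives there. -/
theorem params_ofParams (x : Base) (k : ℕ) (p : Params k) : params x k (ofParams x k p) = p := by
  have c1 : D 0 (cen x 1) = 0 := by simp
  have c2 : D 0 (cen x 2) = 0 := by simp
  have d2 : D 0 (dpow x 2 2) = 0 := D_dpow_of_ne x (by decide) 2
  refine Prod.ext ?_ (Prod.ext ?_ (Prod.ext ?_ (Prod.ext ?_ ?_)))
  · exact tDerivs_tPoly x _ _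
  · change tDerivs x _ (D 2 (ofParams x k p 2)) = _
    rw [D_two_ofParams_two, tDerivs_tPoly]
  · change tDerivs x _ (_ * cen x 2 + tPoly x _ p.2.2.1) = _
    rw [map_add, tDerivs_mul_eq_zero c2 (ev_cen x 2), tDerivs_tPoly, zero_add]
  · change tDerivs x _ (D 2 (ofParams x k p 1)) = _
    rw [D_two_ofParams_one, map_add, tDerivs_mul_eq_zero c2 (ev_cen x 2), tDerivs_tPoly, zero_add]
  · change tDerivs x _ (_ * cen x 1 + _ * dpow x 2 2 + _ * cen x 2 + tPoly x _ p.2.2.2.2) = _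
    rw [map_add, map_add, map_add, tDerivs_mul_eq_zero c1 (ev_cen x 1),
      tDerivs_mul_eq_zero d2 (by simp [ev_dpow]), tDerivs_mul_eq_zero c2 (ev_cen x 2),
      tDerivs_tPoly, zero_add, zero_add, zero_add]

/-- The prolongation factors through the parameters: vanishing of `h` to order `k + 2` exceeds by
one what derivatives of `genS` up to order `k` require. -/
theorem prolongL_eq_zero {k : ℕ} {θ : Jet k} {h : symAlg} (hp : params θ.1 k h.1 = 0) :
    prolongL k θ h = 0 := by
  have p0 : tDerivs θ.1 _ (h.1 0) = 0 := congrArg (fun p => p.1) hp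
  have p1 : tDerivs θ.1 _ (D 2 (h.1 2)) = 0 := congrArg (fun p => p.2.1) hp
  have p2 : tDerivs θ.1 _ (h.1 2) = 0 := congrArg (fun p => p.2.2.1) hp
  have p3 : tDerivs θ.1 _ (D 2 (h.1 1)) = 0 := congrArg (fun p => p.2.2.2.1) hp
  have p4 : tDerivs θ.1 _ (h.1 1) = 0 := congrArg (fun p => p.2.2.2.2) hp
  have ht : ∀ {n : ℕ} {f : Sm}, tDerivs θ.1 n f = 0 → ∀ j < n, ev θ.1 (Dm ![j, 0, 0] f) = 0 :=
    fun h j hj => congrFun h ⟨j, hj⟩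
  have hv := van_of_t_derivs h.2 (ht p0) (ht p2) (ht p4) (ht p1) (ht p3)
  have h0 : ∀ l, ev θ.1 (h.1 l) = 0 := fun l => hv l 0 (by simp)
  refine Prod.ext (funext fun l => h0 l) (funext fun q => ?_)
  refine (prolong_field_snd h.1 θ q).trans ?_
  simp only [proS, map_add, map_mul, h0, zero_mul, add_zero]
  exact van_genS hv (tay θ) q.1 q.2.1 (by have := q.2.2; omega)

theorem params_eq_zero {k : ℕ} {x : Base} {h : Fin 3 → Sm} (hv : ∀ l, Van x (k + 2) (h l)) :
    params x k h = 0 := by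
  have ht : ∀ {n : ℕ} {f : Sm}, Van x n f → tDerivs x n f = 0 :=
    fun hf => funext fun j => hf _ (by simp [Fin.sum_univ_three])
  refine Prod.ext (ht (hv 0)) (Prod.ext (ht ((hv 2).deriv 2)) (Prod.ext (ht (hv 2))
    (Prod.ext (ht ((hv 1).deriv 2)) (ht (hv 1)))))

theorem orbitTangent_eq_range (k : ℕ) (θ : Jet k) :
    orbitTangent k θ = LinearMap.range (prolongL k θ ∘ₗ ofParamsL θ.1 k) := by
  rw [orbitTangent_eq]
  refine le_antisymm ?_ (LinearMap.range_comp_le_range _ _)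
  rintro _ ⟨h, rfl⟩
  refine ⟨params θ.1 k h.1, ?_⟩
  rw [LinearMap.comp_apply, ← sub_eq_zero, ← map_sub]
  apply prolongL_eq_zero
  change params θ.1 k (ofParams θ.1 k (params θ.1 k h.1) - h.1) = 0
  rw [map_sub, params_ofParams, sub_self]

theorem orbitDim_le (k : ℕ) (θ : Jet k) : orbitDim k θ ≤ 5 * k + 8 := by
  rw [orbitDim, orbitTangent_eq_range, ← finrank_Params]
  exact LinearMap.finrank_range_le _

/-- The orbit dimension is bounded below when the isotropy of `θ` is determined by `r` linear
functionals. -/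
theorem le_orbitDim_add {k r : ℕ} (θ : Jet k) (L : (Fin 3 → Sm) →ₗ[ℝ] (Fin r → ℝ))
    (hL : ∀ h : symAlg, prolongL k θ h = 0 → L h.1 = 0 → ∀ l, Van θ.1 (k + 2) (h.1 l)) :
    5 * k + 8 ≤ orbitDim k θ + r := by
  set T := prolongL k θ ∘ₗ ofParamsL θ.1 k with hT
  -- An isotropy parameter killed by `L` is zero, so the kernel of `T` embeds in `Fin r → ℝ`;
  -- rank-nullity concludes.
  have hinj : Function.Injective
      ((L ∘ₗ symAlg.subtype ∘ₗ ofParamsL θ.1 k) ∘ₗ (LinearMap.ker T).subtype) := by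
    rw [← LinearMap.ker_eq_bot, LinearMap.ker_eq_bot']
    rintro ⟨p, hp⟩ hp'
    refine Subtype.ext ((params_ofParams θ.1 k p).symm.trans ?_)
    exact params_eq_zero (hL (ofParamsL θ.1 k p) hp hp')
  have h1 := LinearMap.finrank_le_finrank_of_injective hinj
  have h2 := LinearMap.finrank_range_add_finrank_ker T
  rw [finrank_Params] at h2
  rw [Module.finrank_fin_fun] at h1
  rw [orbitDim, orbitTangent_eq_range, ← hT]
  omega

/-- Once the base value is zero, the transport terms drop out and the prolonged coefficients are the
derivatives of the generating section. -/
theorem isotropy_base {k : ℕ} {θ : Jet k} {h : symAlg} (hp : prolongL k θ h = 0) :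
    (∀ l, ev θ.1 (h.1 l) = 0) ∧ ∀ (α : Fin 2) (σ : Fin 3 → ℕ), ∑ j, σ j ≤ k →
      ev θ.1 (Dm σ (genS h.1 (tay θ) α)) = 0 := by
  have h0 : ∀ l, ev θ.1 (h.1 l) = 0 := fun l => congrFun (congrArg Prod.fst hp) l
  refine ⟨h0, fun α σ hσ => ?_⟩
  have : (prolongL k θ h).2 (α, ⟨σ, hσ⟩) = 0 := congrFun (congrArg Prod.snd hp) (α, ⟨σ, hσ⟩)
  have e := (prolong_field_snd h.1 θ (α, ⟨σ, hσ⟩)).symm.trans this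
  simpa only [proS, map_add, map_mul, h0, zero_mul, add_zero] using e

/-- The index of `u_x`. -/
def idx_ux (k : ℕ) (hk : 1 ≤ k) : Fin 2 × MultiIndex k :=
  (0, ⟨![0, 1, 0], by simpa [Fin.sum_univ_three] using hk⟩)

/-- The index of `u_xx`. -/
def idx_uxx (k : ℕ) (hk : 2 ≤ k) : Fin 2 × MultiIndex k :=
  (0, ⟨![0, 2, 0], by simpa [Fin.sum_univ_three] using hk⟩)

theorem isotropy_C {k : ℕ} (hk : 1 ≤ k) {θ : Jet k} (hx : θ.2 (idx_ux k hk) ≠ 0) {h : symAlg}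
    (hp : prolongL k θ h = 0) : ev θ.1 (D 2 (h.1 2)) = 0 := by
  obtain ⟨h0, hg⟩ := isotropy_base hp
  refine ev_D_two_h2_eq_zero h.2 h0 (s := tay θ) ?_ ?_
  · have := ev_Dm_tay θ 0 ![0, 1, 0]
    rw [dif_pos (by simpa [Fin.sum_univ_three] using hk), Dm_vec] at this
    exact this ▸ hx
  · have := hg 0 ![0, 1, 0] (by simpa [Fin.sum_univ_three] using hk)
    rwa [Dm_vec] at this

theorem isotropy_AB {k : ℕ} (hk : 2 ≤ k) {θ : Jet k} (hx : θ.2 (idx_ux k (by omega)) ≠ 0)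
    (hxx : θ.2 (idx_uxx k hk) ≠ 0) {h : symAlg} (hp : prolongL k θ h = 0) :
    ev θ.1 (D 0 (h.1 0)) = 0 ∧ ev θ.1 (D 2 (h.1 1)) = 0 := by
  obtain ⟨h0, hg⟩ := isotropy_base hp
  refine ev_D_eq_zero h.2 h0 (isotropy_C (by omega) hx hp) (s := tay θ) ?_ ?_ ?_
  · have := ev_Dm_tay θ 0 ![0, 2, 0]
    rw [dif_pos (by simpa [Fin.sum_univ_three] using hk), Dm_vec] at this
    exact this ▸ hxx
  · have := hg 0 ![0, 2, 0] (by simpa [Fin.sum_univ_three] using hk)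
    rwa [Dm_vec] at this
  · have := hg 0 ![0, 1, 1] (by simpa [Fin.sum_univ_three] using hk)
    rwa [Dm_vec] at this

theorem card_multiIndex_zero : Fintype.card (MultiIndex 0) ≤ 1 := by
  rw [Fintype.card_le_one_iff]
  intro σ τ
  refine Subtype.ext (funext fun j => ?_)
  have h1 := Finset.sum_eq_zero_iff.1 (Nat.le_zero.1 σ.2) j (Finset.mem_univ j)
  have h2 := Finset.sum_eq_zero_iff.1 (Nat.le_zero.1 τ.2) j (Finset.mem_univ j)
  rw [h1, h2]

theorem card_multiIndex_one : Fintype.card (MultiIndex 1) ≤ 4 := by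
  have hs : ∀ σ : MultiIndex 1, σ.1 0 + σ.1 1 + σ.1 2 ≤ 1 := fun σ => by
    have := σ.2
    rwa [Fin.sum_univ_three] at this
  have : Function.Injective (fun σ : MultiIndex 1 =>
      (⟨σ.1 0 + 2 * σ.1 1 + 3 * σ.1 2, by have := hs σ; omega⟩ : Fin 4)) := by
    intro σ τ h
    have h' := congrArg Fin.val h
    simp only at h'
    have h1 := hs σ
    have h2 := hs τ
    refine Subtype.ext (funext fun j => ?_)
    fin_cases j <;> simp <;> omega
  simpa using Fintype.card_le_of_injective _ this

theorem orbitDim_le_card (k : ℕ) (θ : Jet k) :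
    orbitDim k θ ≤ 3 + 2 * Fintype.card (MultiIndex k) := by
  refine (Submodule.finrank_le _).trans (le_of_eq ?_)
  rw [Module.finrank_prod, Module.finrank_fin_fun, Module.finrank_fintype_fun_eq_card,
    Fintype.card_prod, Fintype.card_fin]

theorem genericOrbitDim_zero : GenericOrbitDim 0 5 := by
  -- No genericity is needed here: every orbit has the full dimension of `E`, so the constant
  -- polynomial works.
  refine ⟨1, fun θ hθ => subset_closure ⟨hθ, by simp [evalJet]⟩, fun θ _ _ => le_antisymm ?_ ?_⟩
  · have := orbitDim_le_card 0 θ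
    have := card_multiIndex_zero
    omega
  · have := le_orbitDim_add θ (r := 3) (LinearMap.pi
      ![(ev θ.1).toLinearMap ∘ₗ (D 0 : Module.End ℝ Sm) ∘ₗ LinearMap.proj 0,
        (ev θ.1).toLinearMap ∘ₗ (D 2 : Module.End ℝ Sm) ∘ₗ LinearMap.proj 2,
        (ev θ.1).toLinearMap ∘ₗ (D 2 : Module.End ℝ Sm) ∘ₗ LinearMap.proj 1])
      (fun h hp hL => van_of_genS_eq_zero h.2 (isotropy_base hp).1 (congrFun hL 0) (congrFun hL 1)
        (congrFun hL 2) (isotropy_base hp).2)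
    omega

theorem genericOrbitDim_one : GenericOrbitDim 1 11 := by
  refine ⟨MvPolynomial.X (Sum.inr (idx_ux 1 le_rfl)), ?_, fun θ _ hP => le_antisymm ?_ ?_⟩
  · refine (subset_closure_ne_zero {idx_ux 1 le_rfl} (by simp [idx_ux])).trans
      (closure_mono fun θ hθ => ⟨hθ.1, ?_⟩)
    simpa [evalJet] using hθ.2
  · have := orbitDim_le_card 1 θ
    have := card_multiIndex_one
    omega
  · have hx : θ.2 (idx_ux 1 le_rfl) ≠ 0 := by simpa [evalJet] using hP
    -- Since `u_x ≠ 0` removes `∂_y h 2`, only `∂_t h 0` and `∂_y h 1` are left to parametrize the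
    -- isotropy.
    have := le_orbitDim_add θ (r := 2) (LinearMap.pi
      ![(ev θ.1).toLinearMap ∘ₗ (D 0 : Module.End ℝ Sm) ∘ₗ LinearMap.proj 0,
        (ev θ.1).toLinearMap ∘ₗ (D 2 : Module.End ℝ Sm) ∘ₗ LinearMap.proj 1])
      (fun h hp hL => van_of_genS_eq_zero h.2 (isotropy_base hp).1 (congrFun hL 0)
        (isotropy_C le_rfl hx hp) (congrFun hL 1) (isotropy_base hp).2)
    omega

theorem genericOrbitDim_of_two_le {k : ℕ} (hk : 2 ≤ k) : GenericOrbitDim k (5 * k + 8) := by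
  have hk1 : 1 ≤ k := by omega
  refine ⟨MvPolynomial.X (Sum.inr (idx_ux k hk1)) * MvPolynomial.X (Sum.inr (idx_uxx k hk)),
    ?_, fun θ _ hP => le_antisymm (orbitDim_le k θ) ?_⟩
  · refine (subset_closure_ne_zero {idx_ux k hk1, idx_uxx k hk}
      (by simp [idx_ux, idx_uxx])).trans (closure_mono fun θ hθ => ⟨hθ.1, ?_⟩)
    simpa [evalJet] using hθ.2
  · have hx : θ.2 (idx_ux k hk1) ≠ 0 ∧ θ.2 (idx_uxx k hk) ≠ 0 := by simpa [evalJet] using hP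
    exact le_orbitDim_add θ (r := 0) 0 fun h hp _ =>
      van_of_genS_eq_zero h.2 (isotropy_base hp).1 (isotropy_AB hk hx.1 hx.2 hp).1
        (isotropy_C hk1 hx.1 hp) (isotropy_AB hk hx.1 hx.2 hp).2 (isotropy_base hp).2

end MSJet

end

theorem mainTheorem2 :
    MSJet.GenericOrbitDim 0 5 ∧ MSJet.GenericOrbitDim 1 11 ∧
      ∀ k : ℕ, 2 ≤ k → MSJet.GenericOrbitDim k (5 * k + 8) :=
  ⟨MSJet.genericOrbitDim_zero, MSJet.genericOrbitDim_one,
    fun _ hk => MSJet.genericOrbitDim_of_two_le hk⟩
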